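/- Let $I=[0,1]$ (or the circle $\mathbb R/\mathbb Z$, read as $[0,1)$) and let $f:I\to I$ be a $C^2$ map with finitely many critical points, all non-flat (near each critical point $c$, $|f(x)-f(c)|$ is comparable to $|x-c|^{\ell}$ for some $\ell>0$), such that all periodic points are hyperbolically repelling and every iterate $f^n$, $n\ge 1$, has a dense orbit. Let $\mathcal P_1$ be the family of maximal open intervals in $(0,1)$ on which $f$ (for the circle: $f$ taken mod $1$) is continuous and strictly monotone, $\mathcal P_n=\bigvee_{i<n}f^{-i}\mathcal P_1$ (non-empty elements), $\mathcal P_0=\{(0,1)\}$. For $\varphi:I\to\mathbb R$ put $\varphi_n=\sum_{k<n}\varphi\circ f^k$, $\beta_n(\varphi)=\sup_{C\in\mathcal P_n}\sup_{x,y\in C}|\varphi_n(x)-\varphi_n(y)|$ and $$P_{top}(\varphi)=\lim_n \tfrac1n\log\sum_{C\in\mathcal P_n}\sup_{C}e^{\varphi_n}.$$ The Hofbauer tower $\hat I$ is the set of pairs $(x,D)$ with $x\in D\in\mathcal D$, where $\mathcal D=\{f^n(C): n\ge 0,\ C\in\mathcal P_n\}$. If $C\supseteq C'$ are cylinders in $\mathcal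 P_n$ and $\mathcal P_{n+1}$, $D=f^n(C)$ and $D'=f^{n+1}(C')$, write $D\to D'$ and put $\hat f(x,D)=(f(x),D')$ for $x\in f^n(C')$. Put $\hat\varphi(x,D)=\varphi(x)$, $\hat\varphi_n=\sum_{k<n}\hat\varphi\circ\hat f^k$. The $n$-cylinders of the tower, $n\ge 0$, are the non-empty sets $(D\cap C)\times\{D\}$ with $D\in\mathcal D$, $C\in\mathcal P_n$; their family is $\hat{\mathcal P}_n$. The transitive part $\hat I_{trans}$ of the tower is the part over a non-empty closed primitive subgraph $\mathcal E$ of $(\mathcal D,\to)$, i.e. no arrow leaves $\mathcal E$, and any two vertices of $\mathcal E$ are joined by an $n$-path for all sufficiently large $n$. For a cylinder $\hat C$ in $\hat I_{trans}$ let $$P_G(\hat\varphi,\hat C)=\limsup_n\tfrac1n\log\sum_{\hat x\in\hat C,\ \hat f^n\hat x=\hat x}e^{\hat\varphi_n(\hat x)},\qquad P_{top}(\hat\varphi,\hat C)=\lim_n\tfrac1n\log\sum_{\hat J\in\hat{\mathcal P}_n,\ \hat J\subseteq\hat C}\ \sup_{\hat J}e^{\hat\varphi_n}.$$ **Claim.**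 Suppose that $\varphi$ is bounded, $\beta_n(\varphi)=o(n)$ and $\sup\varphi-\inf\varphi<h_{top}(f)$. Then the limits $P_{top}(\varphi)$ and $P_{top}(\hat\varphi,\hat C)$ exist and are finite for every cylinder $\hat C$ (of any order) in $\hat I_{trans}$, $P_{top}(\hat\varphi,\hat C)$ does not depend on $\hat C$ (call it $P_{top}(\hat\varphi)$) and equals $P_{top}(\varphi)$, and $$P_{top}(\hat\varphi)=P_G(\hat\varphi,\hat C)\qquad\text{for every cylinder }\hat C\text{ in }\hat I_{trans}.$$ -/

import Mathlib

open Set Filter Topology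

noncomputable section

namespace HofbauerTower

/-! ### The class of maps -/

/-- `f` maps `[0,1]` into itself, is `C²` with finitely many critical points, all of them non-flat,
all its periodic points are hyperbolically repelling, and every iterate `f^n`, `n ≥ 1`,
has a dense orbit.  Only the values of `f` on `[0,1]` matter. -/
structure IsIntervalMapH (f : ℝ → ℝ) : Prop where
  mapsTo : MapsTo f (Icc 0 1) (Icc 0 1)
  contDiffOn : ContDiffOn ℝ 2 f (Icc 0 1)
  finite_crit : {c ∈ Icc (0 : ℝ) 1 | derivWithin f (Icc 0 1) c = 0}.Finite
  nonflat : ∀ c ∈ Icc (0 : ℝ) 1, derivWithin f (Icc 0 1) c = 0 →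
    ∃ l > (0 : ℝ), ∃ K ≥ (1 : ℝ), ∀ᶠ x in 𝓝[Icc 0 1] c,
      K⁻¹ * |x - c| ^ l ≤ |f x - f c| ∧ |f x - f c| ≤ K * |x - c| ^ l
  repelling : ∀ x ∈ Icc (0 : ℝ) 1, ∀ n ≥ 1, f^[n] x = x → 1 < |derivWithin f^[n] (Icc 0 1) x|
  mixing : ∀ n ≥ 1, ∃ x ∈ Icc (0 : ℝ) 1, Icc 0 1 ⊆ closure (range fun k : ℕ => (f^[n])^[k] x)

/-- The same for a map `g` of the circle `ℝ / ℤ`, expressed through a lift `F : ℝ → ℝ` of `g`. -/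
structure IsCircleMapH (g : UnitAddCircle → UnitAddCircle) : Prop where
  smooth : ∃ F : ℝ → ℝ, ContDiff ℝ 2 F ∧ (∀ x : ℝ, g (x : UnitAddCircle) = (F x : UnitAddCircle)) ∧
    {c ∈ Ico (0 : ℝ) 1 | deriv F c = 0}.Finite ∧
    (∀ c : ℝ, deriv F c = 0 → ∃ l > (0 : ℝ), ∃ K ≥ (1 : ℝ), ∀ᶠ x in 𝓝 c,
      K⁻¹ * |x - c| ^ l ≤ |F x - F c| ∧ |F x - F c| ≤ K * |x - c| ^ l) ∧
    (∀ x : ℝ, ∀ n ≥ 1, g^[n] (x : UnitAddCircle) = (x : UnitAddCircle) → 1 < |deriv F^[n] x|)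
  mixing : ∀ n ≥ 1, ∃ x, Dense (range fun k : ℕ => (g^[n])^[k] x)

/-- A circle map read as a map of `[0,1)`: `x ↦ g x (mod 1)`. -/
def circleRep (g : UnitAddCircle → UnitAddCircle) (x : ℝ) : ℝ :=
  (AddCircle.equivIco (1 : ℝ) 0 (g (x : UnitAddCircle)) : ℝ)

/-- The class of smooth, topologically mixing maps of the interval or the circle. -/
inductive MapH : Type where
  | interval (f : ℝ → ℝ) (hf : IsIntervalMapH f) : MapH
  | circle (g : UnitAddCircle → UnitAddCircle) (hg : IsCircleMapH g) : MapH

/-- The phase space `I`; the circle is read as `[0,1)`. -/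
def MapH.space : MapH → Set ℝ
  | .interval _ _ => Icc 0 1
  | .circle _ _ => Ico 0 1

/-- The map `f : I → I` (its values outside `I` are irrelevant). -/
def MapH.map : MapH → ℝ → ℝ
  | .interval f _ => f
  | .circle g _ => circleRep g

/-- Topological entropy of the (continuous) map on the interval, respectively the circle. -/
def MapH.htop : MapH → EReal
  | .interval f _ => Dynamics.coverEntropy f (Icc 0 1)
  | .circle g _ => Dynamics.coverEntropy g univ

/-! ### Branch partition and cylinders

Intervals of the partitions are taken open, so that `𝒫 n` partitions `I` up to a finite set. -/

/-- An open interval `J ⊆ (0,1)` on which `f` is continuous and strictly monotone. -/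
structure IsMonotoneInterval (f : ℝ → ℝ) (J : Set ℝ) : Prop where
  isOpen : IsOpen J
  nonempty : J.Nonempty
  ordConnected : J.OrdConnected
  subset : J ⊆ Ioo 0 1
  continuousOn : ContinuousOn f J
  strict : StrictMonoOn f J ∨ StrictAntiOn f J

/-- The branch partition `𝒫₁`: the maximal intervals of monotonicity of `f`. -/
def branches (f : ℝ → ℝ) : Set (Set ℝ) := {J | Maximal (IsMonotoneInterval f) J}

/-- `𝒫ₙ = ⋁_{i<n} f⁻ⁱ 𝒫₁` (nonempty elements only); `𝒫₀` consists of the single set `(0,1)`. -/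
def cylinders (f : ℝ → ℝ) (n : ℕ) : Set (Set ℝ) :=
  {C | C.Nonempty ∧ ∃ A : ℕ → Set ℝ, (∀ i < n, A i ∈ branches f) ∧
    C = {x ∈ Ioo (0 : ℝ) 1 | ∀ i < n, f^[i] x ∈ A i}}

/-- `βₙ(φ) = sup_{C ∈ 𝒫ₙ} sup_{x,y ∈ C} |φₙ(x) - φₙ(y)|`. -/
def beta (f φ : ℝ → ℝ) (n : ℕ) : ℝ :=
  sSup {r | ∃ C ∈ cylinders f n, ∃ x ∈ C, ∃ y ∈ C,
    r = |birkhoffSum f φ n x - birkhoffSum f φ n y|}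

/-- `∑_{C ∈ 𝒫ₙ} sup_{x ∈ C} exp φₙ(x)`, whose exponential growth rate is `P_top(φ)`. -/
def topSum (f φ : ℝ → ℝ) (n : ℕ) : ENNReal :=
  ∑' C : cylinders f n, ⨆ x ∈ (C : Set ℝ), ENNReal.ofReal (Real.exp (birkhoffSum f φ n x))

/-! ### The Hofbauer tower -/

/-- The domains `D = fⁿ(C)`, `C ∈ 𝒫ₙ`, `n ≥ 0`. -/
def domains (f : ℝ → ℝ) : Set (Set ℝ) := {D | ∃ n, ∃ C ∈ cylinders f n, D = f^[n] '' C}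

/-- The arrow `D → D'`: there are cylinders `C ⊇ C'` of order `n` and `n + 1`
with `D = fⁿ(C)` and `D' = fⁿ⁺¹(C')`. -/
def Arrow (f : ℝ → ℝ) (D D' : Set ℝ) : Prop :=
  ∃ n, ∃ C ∈ cylinders f n, ∃ C' ∈ cylinders f (n + 1),
    C' ⊆ C ∧ D = f^[n] '' C ∧ D' = f^[n + 1] '' C'

/-- There is an `n`-path `D → ⋯ → D'`. -/
def HasPath (f : ℝ → ℝ) (n : ℕ) (D D' : Set ℝ) : Prop :=
  ∃ p : ℕ → Set ℝ, p 0 = D ∧ p n = D' ∧ ∀ k < n, Arrow f (p k) (p (k + 1))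

/-- Points of the tower are pairs `(x, D)` with `D` a domain and `x ∈ D`.  The map is
`(x, D) ↦ (f x, f (D ∩ A))`, where `A` is the branch containing `x`.  If `x` lies in no branch,
the second entry becomes `∅`, which is not a domain: the point leaves the tower forever. -/
def hatMap (f : ℝ → ℝ) (p : ℝ × Set ℝ) : ℝ × Set ℝ :=
  (f p.1, f '' {y ∈ p.2 | ∃ A ∈ branches f, p.1 ∈ A ∧ y ∈ A})

/-- The lifted potential `φ̂ = φ ∘ π`. -/
def hatPot (φ : ℝ → ℝ) (p : ℝ × Set ℝ) : ℝ := φ p.1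

/-- The elements of `π⁻¹(𝒫ₙ) ∨ 𝒟` that lie in the domains belonging to `E`:
the `n`-cylinders of the part of the tower over `E`. -/
def hatCylinders (f : ℝ → ℝ) (E : Set (Set ℝ)) (n : ℕ) : Set (Set (ℝ × Set ℝ)) :=
  {J | ∃ D ∈ E, ∃ C ∈ cylinders f n, (D ∩ C).Nonempty ∧ J = (D ∩ C) ×ˢ {D}}

/-- `E` is a closed primitive subgraph of the graph of domains: no arrow leaves `E`, and any two
vertices of `E` are joined by an `n`-path for all large `n`.  (The transitive part of the tower
is such a subgraph.) -/
structure IsTransitivePart (f : ℝ → ℝ) (E : Set (Set ℝ)) : Prop where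
  subset : E ⊆ domains f
  nonempty : E.Nonempty
  closed : ∀ D ∈ E, ∀ D', Arrow f D D' → D' ∈ E
  primitive : ∀ D ∈ E, ∀ D' ∈ E, ∀ᶠ n in atTop, HasPath f n D D'

/-- `∑ sup_{Ĵ} exp φ̂ₙ` over the `n`-cylinders `Ĵ` of the tower contained in `Ĉ`. -/
def hatTopSum (f φ : ℝ → ℝ) (Chat : Set (ℝ × Set ℝ)) (n : ℕ) : ENNReal :=
  ∑' J : {J // J ∈ hatCylinders f (domains f) n ∧ J ⊆ Chat},
    ⨆ p ∈ (J : Set (ℝ × Set ℝ)),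
      ENNReal.ofReal (Real.exp (birkhoffSum (hatMap f) (hatPot φ) n p))

/-- `Zₙ(φ̂, Ĉ) = ∑_{f̂ⁿ x̂ = x̂} exp (φ̂ₙ x̂) 1_Ĉ(x̂)`. -/
def hatZ (f φ : ℝ → ℝ) (Chat : Set (ℝ × Set ℝ)) (n : ℕ) : ENNReal :=
  ∑' p : {p // p ∈ Chat ∧ (hatMap f)^[n] p = p},
    ENNReal.ofReal (Real.exp (birkhoffSum (hatMap f) (hatPot φ) n p))

/-- Gurevich pressure `P_G(φ̂, Ĉ) = limsup (1/n) log Zₙ(φ̂, Ĉ)`, with `log 0 = -∞`. -/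
def hatGurevich (f φ : ℝ → ℝ) (Chat : Set (ℝ × Set ℝ)) : EReal :=
  limsup (fun n : ℕ => ENNReal.log (hatZ f φ Chat n) / n) atTop

/-! ### The tower map is the one given by nested cylinders -/

theorem IsMonotoneInterval.union {f : ℝ → ℝ} {A B : Set ℝ} (hA : IsMonotoneInterval f A)
    (hB : IsMonotoneInterval f B) {x : ℝ} (hxA : x ∈ A) (hxB : x ∈ B) :
    IsMonotoneInterval f (A ∪ B) := by
  have key : ∀ {A B : Set ℝ}, A.OrdConnected → B.OrdConnected → x ∈ A → x ∈ B → ∀ u ∈ A, ∀ v ∈ B,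
      u < v → (u ∈ A ∧ v ∈ A) ∨ (u ∈ B ∧ v ∈ B) ∨ (u < x ∧ x < v) := by
    intro A B oA oB hxA hxB u hu v hv huv
    rcases le_or_gt x u with h | h
    · exact Or.inr (Or.inl ⟨oB.out hxB hv ⟨h, huv.le⟩, hv⟩)
    rcases le_or_gt v x with h' | h'
    · exact Or.inl ⟨hu, oA.out hu hxA ⟨huv.le, h'⟩⟩
    · exact Or.inr (Or.inr ⟨h, h'⟩)
  have hopp : ∃ y ∈ A ∩ B, x < y := by
    have h1 : A ∩ B ∈ 𝓝 x := (hA.isOpen.inter hB.isOpen).mem_nhds ⟨hxA, hxB⟩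
    have h2 : ∀ᶠ y in 𝓝[>] x, y ∈ A ∩ B := mem_nhdsWithin_of_mem_nhds h1
    obtain ⟨y, hy, hxy⟩ := (h2.and self_mem_nhdsWithin).exists
    exact ⟨y, hy, hxy⟩
  obtain ⟨y, ⟨hyA, hyB⟩, hxy⟩ := hopp
  refine ⟨hA.isOpen.union hB.isOpen, hA.nonempty.inl, ?_, union_subset hA.subset hB.subset,
    hA.continuousOn.union_of_isOpen hB.continuousOn hA.isOpen hB.isOpen, ?_⟩
  · exact (hA.ordConnected.isPreconnected.union x hxA hxB
      hB.ordConnected.isPreconnected).ordConnected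
  · rcases hA.strict with mA | mA <;> rcases hB.strict with mB | mB
    · left
      rintro u (hu | hu) v (hv | hv) huv
      · exact mA hu hv huv
      · rcases key hA.ordConnected hB.ordConnected hxA hxB u hu v hv huv with h | h | h
        · exact mA h.1 h.2 huv
        · exact mB h.1 h.2 huv
        · exact (mA hu hxA h.1).trans (mB hxB hv h.2)
      · rcases key hB.ordConnected hA.ordConnected hxB hxA u hu v hv huv with h | h | h
        · exact mB h.1 h.2 huv
        · exact mA h.1 h.2 huv
        · exact (mB hu hxB h.1).trans (mA hxA hv h.2)
      · exact mB hu hv huv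
    · exact absurd (mA hxA hyA hxy) (mB hxB hyB hxy).not_gt
    · exact absurd (mB hxB hyB hxy) (mA hxA hyA hxy).not_gt
    · right
      rintro u (hu | hu) v (hv | hv) huv
      · exact mA hu hv huv
      · rcases key hA.ordConnected hB.ordConnected hxA hxB u hu v hv huv with h | h | h
        · exact mA h.1 h.2 huv
        · exact mB h.1 h.2 huv
        · exact (mB hxB hv h.2).trans (mA hu hxA h.1)
      · rcases key hB.ordConnected hA.ordConnected hxB hxA u hu v hv huv with h | h | h
        · exact mB h.1 h.2 huv
        · exact mA h.1 h.2 huv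
        · exact (mA hxA hv h.2).trans (mB hu hxB h.1)
      · exact mB hu hv huv

/-- Distinct branches are disjoint. -/
theorem branches_eq {f : ℝ → ℝ} {A B : Set ℝ} (hA : A ∈ branches f) (hB : B ∈ branches f)
    {x : ℝ} (hxA : x ∈ A) (hxB : x ∈ B) : A = B := by
  have h := hA.prop.union hB.prop hxA hxB
  rw [hA.eq_of_le h subset_union_left, ← hB.eq_of_le h subset_union_right]

/-- If `C ⊇ C'` are cylinders of order `n` and `n + 1` and `x ∈ fⁿ(C')`, then the tower map sends
`(x, fⁿ(C))` to `(f x, fⁿ⁺¹(C'))`. -/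
theorem hatMap_eq {f : ℝ → ℝ} {n : ℕ} {C C' : Set ℝ} (hC : C ∈ cylinders f n)
    (hC' : C' ∈ cylinders f (n + 1)) (hCC : C' ⊆ C) {x : ℝ} (hx : x ∈ f^[n] '' C') :
    hatMap f (x, f^[n] '' C) = (f x, f^[n + 1] '' C') := by
  obtain ⟨-, B, hB, rfl⟩ := hC
  obtain ⟨-, A, hA, rfl⟩ := hC'
  obtain ⟨z, ⟨hz, hzA⟩, rfl⟩ := hx
  have hAB : ∀ i < n, A i = B i := fun i hi =>
    branches_eq (hA i (by omega)) (hB i hi) (hzA i (by omega)) ((hCC ⟨hz, hzA⟩).2 i hi)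
  simp only [hatMap, Prod.mk.injEq, true_and]
  ext w
  constructor
  · rintro ⟨y, ⟨⟨u, ⟨hu, huB⟩, rfl⟩, A', hA', hzA', huA'⟩, rfl⟩
    have : A' = A n := branches_eq hA' (hA n (by omega)) hzA' (hzA n (by omega))
    subst this
    refine ⟨u, ⟨hu, fun i hi => ?_⟩, Function.iterate_succ_apply' f n u⟩
    rcases Nat.lt_succ_iff_lt_or_eq.mp hi with h | rfl
    · rw [hAB i h]; exact huB i h
    · exact huA'
  · rintro ⟨u, hu, rfl⟩
    exact ⟨f^[n] u, ⟨⟨u, hCC hu, rfl⟩, A n, hA n (by omega), hzA n (by omega), hu.2 n (by omega)⟩,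
      (Function.iterate_succ_apply' f n u).symm⟩

end HofbauerTower

end

/-!
The sums `topSum` are submultiplicative, so the pressure `P` of `φ` exists. A continuous monotone
`1 / M`-code of orbit segments shows that the entropy is at most the growth rate of the number of
cylinders, hence `sup φ < P`.

Every domain in the transitive part is mapped over `(0,1)` by an iterate of `f`: by mixing and
repelling periodic points a small interval has an image that covers itself, and its images increase
to all of `(0,1)`. So the cylinders that meet a domain carry the whole pressure, which gives the
lower bound for the sums over tower cylinders; the upper bounds hold term by term.

For periodic points, note that all but at most two of the cylinders of order `R` that meet an
interval are contained in it. The paths in the tower that avoid the finitely many domains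
`f^R(C)`, `C` a cylinder of order `R`, during the last `R` steps therefore contribute at most a
factor `2 exp (R sup φ)` per `R` steps, which is negligible for large `R` because `sup φ < P`.
The remaining paths end in finitely many domains and can be closed up by paths of one fixed length,
and a monotone branch that maps onto a neighbourhood of itself has a fixed point.
-/

noncomputable section

namespace HofbauerTower

/-! ### Monotone intervals and branches -/

lemma eq_Ioo_csInf_csSup {α : Type*} [ConditionallyCompleteLinearOrder α] [TopologicalSpace α]
    [OrderTopology α] [DenselyOrdered α] [NoMinOrder α] [NoMaxOrder α] {J : Set α} (ho : IsOpen J)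
    (hne : J.Nonempty) (hoc : J.OrdConnected) (hbelow : BddBelow J) (habove : BddAbove J) :
    J = Ioo (sInf J) (sSup J) := by
  refine Subset.antisymm ?_
    (IsConnected.Ioo_csInf_csSup_subset ⟨hne, hoc.isPreconnected⟩ hbelow habove)
  rw [← interior_Icc]
  exact interior_maximal (subset_Icc_csInf_csSup hbelow habove) ho

namespace IsMonotoneInterval

variable {f h : ℝ → ℝ} {A B J K : Set ℝ}

lemma eq_Ioo (hJ : IsMonotoneInterval f J) : J = Ioo (sInf J) (sSup J) :=
  eq_Ioo_csInf_csSup hJ.isOpen hJ.nonempty hJ.ordConnected (bddBelow_Ioo.mono hJ.subset)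
    (bddAbove_Ioo.mono hJ.subset)

lemma injOn (hJ : IsMonotoneInterval f J) : InjOn f J :=
  hJ.strict.elim StrictMonoOn.injOn StrictAntiOn.injOn

lemma of_injOn (ho : IsOpen J) (hne : J.Nonempty) (hoc : J.OrdConnected) (hsub : J ⊆ Ioo 0 1)
    (hcont : ContinuousOn f J) (hinj : InjOn f J) : IsMonotoneInterval f J where
  isOpen := ho
  nonempty := hne
  ordConnected := hoc
  subset := hsub
  continuousOn := hcont
  strict := by
    have hJ := eq_Ioo_csInf_csSup ho hne hoc (bddBelow_Ioo.mono hsub) (bddAbove_Ioo.mono hsub)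
    rw [hJ] at hcont hinj hne ⊢
    exact ContinuousOn.strictMonoOn_of_injOn_Ioo (nonempty_Ioo.1 hne) hcont hinj

lemma mono (hJ : IsMonotoneInterval f J) (hK : IsOpen K) (hne : K.Nonempty)
    (hoc : K.OrdConnected) (hKJ : K ⊆ J) : IsMonotoneInterval f K :=
  .of_injOn hK hne hoc (hKJ.trans hJ.subset) (hJ.continuousOn.mono hKJ) (hJ.injOn.mono hKJ)

lemma ordConnected_image (hJ : IsMonotoneInterval f J) : (f '' J).OrdConnected :=
  (hJ.ordConnected.isPreconnected.image f hJ.continuousOn).ordConnected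

lemma isOpen_image (hJ : IsMonotoneInterval f J) : IsOpen (f '' J) := by
  rw [isOpen_iff_mem_nhds]
  rintro _ ⟨x, hx, rfl⟩
  have hnhds : ∀ᶠ y in 𝓝 x, y ∈ J := hJ.isOpen.mem_nhds hx
  obtain ⟨y, hyx, hy⟩ := hnhds.exists_lt
  obtain ⟨z, hxz, hz⟩ := hnhds.exists_gt
  rcases hJ.strict with hs | hs
  · exact mem_of_superset (Icc_mem_nhds (hs hy hx hyx) (hs hx hz hxz))
      (hJ.ordConnected_image.out (mem_image_of_mem f hy) (mem_image_of_mem f hz))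
  · exact mem_of_superset (Icc_mem_nhds (hs hx hz hxz) (hs hy hx hyx))
      (hJ.ordConnected_image.out (mem_image_of_mem f hz) (mem_image_of_mem f hy))

lemma ordConnected_inter_preimage (hJ : IsMonotoneInterval h J) (hA : A.OrdConnected) :
    (J ∩ h ⁻¹' A).OrdConnected := by
  refine ⟨fun x hx y hy z hz => ?_⟩
  have hzJ : z ∈ J := hJ.ordConnected.out hx.1 hy.1 hz
  refine ⟨hzJ, ?_⟩
  rcases hJ.strict with hs | hs
  · exact hA.out hx.2 hy.2 ⟨hs.monotoneOn hx.1 hzJ hz.1, hs.monotoneOn hzJ hy.1 hz.2⟩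
  · exact hA.out hy.2 hx.2 ⟨hs.antitoneOn hzJ hy.1 hz.2, hs.antitoneOn hx.1 hzJ hz.1⟩

lemma comp (hA : IsMonotoneInterval f A) (hJ : IsMonotoneInterval h J)
    (hne : (J ∩ h ⁻¹' A).Nonempty) : IsMonotoneInterval (f ∘ h) (J ∩ h ⁻¹' A) :=
  .of_injOn (hJ.continuousOn.isOpen_inter_preimage hJ.isOpen hA.isOpen) hne
    (hJ.ordConnected_inter_preimage hA.ordConnected) (inter_subset_left.trans hJ.subset)
    (hA.continuousOn.comp (hJ.continuousOn.mono inter_subset_left) fun _ hx => hx.2)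
    (hA.injOn.comp (hJ.injOn.mono inter_subset_left) fun _ hx => hx.2)

lemma exists_branch (hJ : IsMonotoneInterval f J) : ∃ A ∈ branches f, J ⊆ A := by
  obtain ⟨x, hx⟩ := hJ.nonempty
  let 𝒥 : Set (Set ℝ) := {K | IsMonotoneInterval f K ∧ x ∈ K}
  have hdir : ∀ u ∈ ⋃₀ 𝒥, ∀ v ∈ ⋃₀ 𝒥, ∃ K ∈ 𝒥, u ∈ K ∧ v ∈ K := by
    rintro u ⟨K, hK, hu⟩ v ⟨L, hL, hv⟩
    exact ⟨K ∪ L, ⟨hK.1.union hL.1 hK.2 hL.2, .inl hK.2⟩, .inl hu, .inr hv⟩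
  have hsub : J ⊆ ⋃₀ 𝒥 := subset_sUnion_of_mem ⟨hJ, hx⟩
  have hunion : IsMonotoneInterval f (⋃₀ 𝒥) := by
    refine .of_injOn (isOpen_sUnion fun K hK => hK.1.isOpen) ⟨x, hsub hx⟩
      ⟨fun u hu v hv z hz => ?_⟩ (sUnion_subset fun K hK => hK.1.subset) ?_
      fun u hu v hv huv => ?_
    · obtain ⟨K, hK, huK, hvK⟩ := hdir u hu v hv
      exact ⟨K, hK, hK.1.ordConnected.out huK hvK hz⟩
    · rintro u ⟨K, hK, hu⟩
      exact (hK.1.continuousOn.continuousAt (hK.1.isOpen.mem_nhds hu)).continuousWithinAt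
    · obtain ⟨K, hK, huK, hvK⟩ := hdir u hu v hv
      exact hK.1.injOn huK hvK huv
  exact ⟨_, ⟨hunion, fun K hK hle => subset_sUnion_of_mem ⟨hK, hle (hsub hx)⟩⟩, hsub⟩

end IsMonotoneInterval

section Branches

variable {f : ℝ → ℝ} {A B : Set ℝ}

lemma Ioo_mem_nhdsLT_csSup (hA : A ∈ branches f) : A ∈ 𝓝[<] sSup A := by
  have hne := hA.prop.nonempty
  rw [hA.prop.eq_Ioo] at hne
  have hmem := Ioo_mem_nhdsLT (nonempty_Ioo.1 hne)
  rwa [← hA.prop.eq_Ioo] at hmem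

lemma csSup_notMem_of_mem_branches (hA : A ∈ branches f) (hB : B ∈ branches f) : sSup A ∉ B := by
  intro hmem
  obtain ⟨x, hxA, hxB⟩ := Filter.nonempty_of_mem (inter_mem (Ioo_mem_nhdsLT_csSup hA)
    (mem_nhdsWithin_of_mem_nhds (hB.prop.isOpen.mem_nhds hmem)))
  rw [← branches_eq hA hB hxA hxB] at hmem
  exact (hA.prop.eq_Ioo.subset hmem).2.false

lemma injOn_csSup_branches : InjOn sSup (branches f) := by
  intro A hA B hB hAB
  obtain ⟨x, hxA, hxB⟩ := Filter.nonempty_of_mem (inter_mem (Ioo_mem_nhdsLT_csSup hA)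
    (hAB ▸ Ioo_mem_nhdsLT_csSup hB))
  exact branches_eq hA hB hxA hxB

lemma finite_branches (h : (Icc (0 : ℝ) 1 \ ⋃₀ branches f).Finite) : (branches f).Finite := by
  refine Finite.of_finite_image (h.subset ?_) injOn_csSup_branches
  rintro _ ⟨A, hA, rfl⟩
  have hle : ∀ x ∈ A, x ≤ 1 := fun x hx => (hA.prop.subset hx).2.le
  obtain ⟨x, hx⟩ := hA.prop.nonempty
  refine ⟨⟨(hA.prop.subset hx).1.le.trans (le_csSup ⟨1, hle⟩ hx), csSup_le ⟨x, hx⟩ hle⟩, ?_⟩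
  rintro ⟨B, hB, hmem⟩
  exact csSup_notMem_of_mem_branches hA hB hmem

end Branches

/-! ### Cylinders -/

/-- A piecewise monotone self-map of `X`, where `X` is `(0,1)` together with some of its endpoints:
the branches of `f` exhaust `[0,1]` up to finitely many points. -/
structure IsPiecewiseMonotone (f : ℝ → ℝ) (X : Set ℝ) : Prop where
  Ioo_subset : Ioo 0 1 ⊆ X
  subset_Icc : X ⊆ Icc 0 1
  mapsTo : MapsTo f X X
  finite_exceptional : (Icc (0 : ℝ) 1 \ ⋃₀ branches f).Finite

/-- The set of points of `(0,1)` whose orbit visits `A 0, …, A (n - 1)` in this order. The nonempty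
itineraries through branches are the cylinders of order `n`. -/
def itinerary (f : ℝ → ℝ) (n : ℕ) (A : ℕ → Set ℝ) : Set ℝ :=
  {x ∈ Ioo (0 : ℝ) 1 | ∀ i < n, f^[i] x ∈ A i}

section Cylinders

variable {f : ℝ → ℝ} {A B : ℕ → Set ℝ} {X C C' D : Set ℝ} {n m : ℕ} {x : ℝ}

lemma itinerary_zero (f : ℝ → ℝ) (A : ℕ → Set ℝ) : itinerary f 0 A = Ioo 0 1 := by
  ext x
  simp [itinerary]

lemma itinerary_succ (f : ℝ → ℝ) (n : ℕ) (A : ℕ → Set ℝ) :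
    itinerary f (n + 1) A = itinerary f n A ∩ f^[n] ⁻¹' A n := by
  ext x
  simp only [itinerary, mem_ofPred_eq, mem_inter_iff, mem_preimage, Nat.forall_lt_succ_right,
    and_assoc]

lemma itinerary_anti (f : ℝ → ℝ) (A : ℕ → Set ℝ) : Antitone fun n => itinerary f n A :=
  fun _ _ hmn _ hx => ⟨hx.1, fun i hi => hx.2 i (hi.trans_le hmn)⟩

lemma itinerary_congr (h : ∀ i < n, A i = B i) : itinerary f n A = itinerary f n B := by
  ext x
  exact and_congr_right fun _ => forall₂_congr fun i hi => by rw [h i hi]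

lemma isMonotoneInterval_itinerary (hA : ∀ i < n, A i ∈ branches f)
    (hne : (itinerary f n A).Nonempty) : IsMonotoneInterval f^[n] (itinerary f n A) := by
  induction n with
  | zero =>
    rw [itinerary_zero]
    exact .of_injOn isOpen_Ioo (nonempty_Ioo.2 one_pos) ordConnected_Ioo subset_rfl continuousOn_id
      (injOn_id _)
  | succ n ih =>
    have hmono := ih (fun i hi => hA i (by lia)) (hne.mono (itinerary_anti f A n.le_succ))
    rw [itinerary_succ] at hne ⊢
    rw [Function.iterate_succ']
    exact (hA n n.lt_succ_self).prop.comp hmono hne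

lemma isMonotoneInterval_iterate (hC : C ∈ cylinders f n) (hm : m ≤ n) :
    IsMonotoneInterval f^[m] C := by
  have hstep : ∀ {k}, C ∈ cylinders f k → IsMonotoneInterval f^[k] C := by
    rintro k ⟨hne, A, hA, rfl⟩
    exact isMonotoneInterval_itinerary hA hne
  obtain ⟨hne, A, hA, rfl⟩ := id hC
  have hsub := itinerary_anti f A hm
  exact (isMonotoneInterval_itinerary (fun i hi => hA i (hi.trans_le hm)) (hne.mono hsub)).mono
    (hstep hC).isOpen hne (hstep hC).ordConnected hsub

lemma subset_Ioo_of_mem_cylinders (hC : C ∈ cylinders f n) : C ⊆ Ioo 0 1 :=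
  (isMonotoneInterval_iterate hC le_rfl).subset

lemma isOpen_of_mem_cylinders (hC : C ∈ cylinders f n) : IsOpen C :=
  (isMonotoneInterval_iterate hC le_rfl).isOpen

lemma ordConnected_of_mem_cylinders (hC : C ∈ cylinders f n) : C.OrdConnected :=
  (isMonotoneInterval_iterate hC le_rfl).ordConnected

lemma eq_of_mem_cylinders (hC : C ∈ cylinders f n) (hC' : C' ∈ cylinders f n) (hx : x ∈ C)
    (hx' : x ∈ C') : C = C' := by
  obtain ⟨-, A, hA, rfl⟩ := hC
  obtain ⟨-, B, hB, rfl⟩ := hC'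
  exact itinerary_congr fun i hi => branches_eq (hA i hi) (hB i hi) (hx.2 i hi) (hx'.2 i hi)

lemma exists_mem_cylinders (hx : x ∈ Ioo (0 : ℝ) 1) (h : ∀ i < n, f^[i] x ∈ ⋃₀ branches f) :
    ∃ C ∈ cylinders f n, x ∈ C := by
  choose! A hA hxA using h
  exact ⟨itinerary f n A, ⟨⟨x, hx, hxA⟩, A, hA, rfl⟩, hx, hxA⟩

namespace IsPiecewiseMonotone

lemma finite_cylinders (hf : IsPiecewiseMonotone f X) (n : ℕ) : (cylinders f n).Finite := by
  have : Finite (branches f) := (finite_branches hf.finite_exceptional).to_subtype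
  refine (finite_range fun A : Fin n → branches f =>
    {x ∈ Ioo (0 : ℝ) 1 | ∀ i : Fin n, f^[i] x ∈ (A i : Set ℝ)}).subset ?_
  rintro C ⟨-, A, hA, rfl⟩
  refine ⟨fun i => ⟨A i, hA i i.2⟩, ?_⟩
  ext x
  simp only [mem_ofPred_eq, Fin.forall_iff]

lemma finite_preimage (hf : IsPiecewiseMonotone f X) {S : Set ℝ} (hS : S.Finite) :
    (X ∩ f ⁻¹' S).Finite := by
  have hbranches : (⋃ A ∈ branches f, A ∩ f ⁻¹' S).Finite := by
    refine (finite_branches hf.finite_exceptional).biUnion fun A hA => ?_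
    have hinj : InjOn f (A ∩ f ⁻¹' S) := hA.prop.injOn.mono inter_subset_left
    exact .of_finite_image (hS.subset (image_subset_iff.2 inter_subset_right)) hinj
  refine (hbranches.union hf.finite_exceptional).subset ?_
  rintro x ⟨hx, hxS⟩
  by_cases h : x ∈ ⋃₀ branches f
  · obtain ⟨A, hA, hxA⟩ := h
    exact .inl (mem_biUnion hA ⟨hxA, hxS⟩)
  · exact .inr ⟨hf.subset_Icc hx, h⟩

lemma finite_exceptional_iterate (hf : IsPiecewiseMonotone f X) (n : ℕ) :
    {x ∈ X | ∃ i < n, f^[i] x ∉ ⋃₀ branches f}.Finite := by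
  have hexc : ∀ i, {x ∈ X | f^[i] x ∉ ⋃₀ branches f}.Finite := by
    intro i
    induction i with
    | zero => exact hf.finite_exceptional.subset fun x hx => ⟨hf.subset_Icc hx.1, hx.2⟩
    | succ i ih => exact (hf.finite_preimage ih).subset fun x hx => ⟨hx.1, hf.mapsTo hx.1, hx.2⟩
  refine ((finite_lt_nat n).biUnion fun i _ => hexc i).subset ?_
  rintro x ⟨hx, i, hi, h⟩
  exact mem_biUnion hi ⟨hx, h⟩

lemma image_subset_Ioo (hf : IsPiecewiseMonotone f X) (hC : C ∈ cylinders f n) :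
    f^[n] '' C ⊆ Ioo 0 1 := by
  rw [← interior_Icc]
  refine interior_maximal ?_ (isMonotoneInterval_iterate hC le_rfl).isOpen_image
  rintro _ ⟨x, hx, rfl⟩
  exact hf.subset_Icc (hf.mapsTo.iterate n (hf.Ioo_subset (subset_Ioo_of_mem_cylinders hC hx)))

lemma itinerary_add (hf : IsPiecewiseMonotone f X) (hA : ∀ i < n, A i ∈ branches f) (m : ℕ) :
    itinerary f (n + m) A =
      itinerary f n A ∩ f^[n] ⁻¹' itinerary f m fun i => A (n + i) := by
  ext x
  constructor
  · intro hx
    have hxn : x ∈ itinerary f n A := itinerary_anti f A (n.le_add_right m) hx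
    refine ⟨hxn, hf.image_subset_Ioo ⟨⟨x, hxn⟩, A, hA, rfl⟩ (mem_image_of_mem _ hxn),
      fun i hi => ?_⟩
    rw [← Function.iterate_add_apply, add_comm]
    exact hx.2 (n + i) (by lia)
  · rintro ⟨hx, hx'⟩
    refine ⟨hx.1, fun i hi => ?_⟩
    rcases lt_or_ge i n with h | h
    · exact hx.2 i h
    · obtain ⟨j, rfl⟩ := Nat.exists_eq_add_of_le' h
      rw [Function.iterate_add_apply, add_comm j n]
      exact hx'.2 j (by lia)

lemma inter_preimage_mem_cylinders (hf : IsPiecewiseMonotone f X) (hC : C ∈ cylinders f n)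
    (hC' : C' ∈ cylinders f m) (hne : (C ∩ f^[n] ⁻¹' C').Nonempty) :
    C ∩ f^[n] ⁻¹' C' ∈ cylinders f (n + m) := by
  refine ⟨hne, ?_⟩
  obtain ⟨-, A, hA, rfl⟩ := hC
  obtain ⟨-, B, hB, rfl⟩ := hC'
  let AB : ℕ → Set ℝ := fun i => if i < n then A i else B (i - n)
  have hleft : ∀ i < n, AB i = A i := fun i hi => if_pos hi
  have hright : ∀ i, AB (n + i) = B i := by simp [AB]
  refine ⟨AB, fun i hi => ?_, ?_⟩
  · simp only [AB]
    split_ifs with h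
    exacts [hA i h, hB _ (by lia)]
  · change itinerary f n A ∩ f^[n] ⁻¹' itinerary f m B = itinerary f (n + m) AB
    rw [hf.itinerary_add (fun i hi => hleft i hi ▸ hA i hi), itinerary_congr hleft]
    simp only [hright]

lemma exists_eq_inter_preimage (hf : IsPiecewiseMonotone f X) (hC : C ∈ cylinders f (n + m)) :
    ∃ C₁ ∈ cylinders f n, ∃ C₂ ∈ cylinders f m, C = C₁ ∩ f^[n] ⁻¹' C₂ := by
  obtain ⟨⟨x, hx⟩, A, hA, rfl⟩ := hC
  have hA' : ∀ i < n, A i ∈ branches f := fun i hi => hA i (by lia)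
  have hadd := hf.itinerary_add hA' m
  obtain ⟨hx₁, hx₂⟩ := hadd.subset hx
  exact ⟨_, ⟨⟨x, hx₁⟩, A, hA', rfl⟩, itinerary f m fun i => A (n + i),
    ⟨⟨_, hx₂⟩, _, fun i hi => hA (n + i) (by lia), rfl⟩, hadd⟩

end IsPiecewiseMonotone

lemma image_iterate_add_inter_preimage {α : Type*} (f : α → α) (n m : ℕ) (D C C' : Set α) :
    f^[n + m] '' (D ∩ (C ∩ f^[n] ⁻¹' C')) = f^[m] '' (f^[n] '' (D ∩ C) ∩ C') := by
  rw [add_comm n m, Function.iterate_add, image_comp, ← inter_assoc, image_inter_preimage]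

end Cylinders

/-! ### The tower -/

section Tower

variable {f φ : ℝ → ℝ} {X A C D D' : Set ℝ} {E : Set (Set ℝ)} {n i : ℕ} {x : ℝ}

lemma nonempty_of_mem_domains (hD : D ∈ domains f) : D.Nonempty := by
  obtain ⟨n, C, hC, rfl⟩ := hD
  exact hC.1.image _

lemma isOpen_of_mem_domains (hD : D ∈ domains f) : IsOpen D := by
  obtain ⟨n, C, hC, rfl⟩ := hD
  exact (isMonotoneInterval_iterate hC le_rfl).isOpen_image

lemma ordConnected_of_mem_domains (hD : D ∈ domains f) : D.OrdConnected := by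
  obtain ⟨n, C, hC, rfl⟩ := hD
  exact (isMonotoneInterval_iterate hC le_rfl).ordConnected_image

lemma IsPiecewiseMonotone.subset_Ioo_of_mem_domains (hf : IsPiecewiseMonotone f X)
    (hD : D ∈ domains f) : D ⊆ Ioo 0 1 := by
  obtain ⟨n, C, hC, rfl⟩ := hD
  exact hf.image_subset_Ioo hC

lemma hatMap_of_mem (hA : A ∈ branches f) (hx : x ∈ A) (D : Set ℝ) :
    hatMap f (x, D) = (f x, f '' (D ∩ A)) := by
  have hbranch : {y ∈ D | ∃ A ∈ branches f, x ∈ A ∧ y ∈ A} = D ∩ A := by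
    ext y
    refine and_congr_right fun _ => ⟨?_, fun hy => ⟨A, hA, hx, hy⟩⟩
    rintro ⟨A', hA', hxA', hy⟩
    exact branches_eq hA' hA hxA' hx ▸ hy
  simp only [hatMap, hbranch]

lemma hatMap_iterate_of_mem (hC : C ∈ cylinders f n) (hx : x ∈ C) (hD : D ⊆ Ioo 0 1) :
    (hatMap f)^[n] (x, D) = (f^[n] x, f^[n] '' (D ∩ C)) := by
  obtain ⟨-, A, hA, rfl⟩ := hC
  change x ∈ itinerary f n A at hx
  change _ = (f^[n] x, f^[n] '' (D ∩ itinerary f n A))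
  induction n with
  | zero => simp [itinerary_zero, inter_eq_left.2 hD]
  | succ n ih =>
    rw [Function.iterate_succ_apply',
      ih (fun i hi => hA i (by lia)) (itinerary_anti f A n.le_succ hx),
      hatMap_of_mem (hA n n.lt_succ_self) (hx.2 n n.lt_succ_self), itinerary_succ,
      image_iterate_add_inter_preimage, Function.iterate_succ_apply', Function.iterate_one]

lemma hatMap_iterate_fst (p : ℝ × Set ℝ) (n : ℕ) : ((hatMap f)^[n] p).1 = f^[n] p.1 := by
  induction n with
  | zero => rfl
  | succ n ih => rw [Function.iterate_succ_apply', Function.iterate_succ_apply', ← ih]; rfl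

lemma birkhoffSum_hatMap (p : ℝ × Set ℝ) (n : ℕ) :
    birkhoffSum (hatMap f) (hatPot φ) n p = birkhoffSum f φ n p.1 := by
  simp only [birkhoffSum, hatPot, hatMap_iterate_fst]

lemma hatMap_iterate_snd_eq_empty (hi : i < n) (hx : f^[i] x ∉ ⋃₀ branches f) (D : Set ℝ) :
    ((hatMap f)^[n] (x, D)).2 = ∅ := by
  induction n with
  | zero => exact absurd hi i.not_lt_zero
  | succ n ih =>
    rw [Function.iterate_succ_apply', hatMap, image_eq_empty]
    refine eq_empty_of_forall_notMem ?_
    rintro y ⟨hy, A, hA, hxA, -⟩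
    rcases Nat.lt_succ_iff_lt_or_eq.1 hi with hin | rfl
    · rwa [ih hin] at hy
    · exact hx ⟨A, hA, hatMap_iterate_fst (x, D) i ▸ hxA⟩

lemma exists_mem_cylinders_of_hatMap_iterate_eq (hx : x ∈ D) (hD : D ⊆ Ioo 0 1)
    (hper : (hatMap f)^[n] (x, D) = (x, D)) : ∃ C ∈ cylinders f n, x ∈ C := by
  refine exists_mem_cylinders (hD hx) fun i hi => ?_
  by_contra hxi
  have hempty : D = ∅ := by simpa only [hper] using hatMap_iterate_snd_eq_empty hi hxi D
  exact hempty.subset hx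

lemma Ioo_mem_cylinders_zero (f : ℝ → ℝ) : Ioo (0 : ℝ) 1 ∈ cylinders f 0 :=
  ⟨nonempty_Ioo.2 one_pos, fun _ => univ, by simp, (itinerary_zero f _).symm⟩

lemma eq_Ioo_of_mem_cylinders_zero (hC : C ∈ cylinders f 0) : C = Ioo 0 1 := by
  obtain ⟨x, hx⟩ := hC.1
  exact eq_of_mem_cylinders hC (Ioo_mem_cylinders_zero f) hx (subset_Ioo_of_mem_cylinders hC hx)

lemma Arrow.mem_domains (h : Arrow f D D') : D' ∈ domains f := by
  obtain ⟨n, -, -, C', hC', -, -, rfl⟩ := h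
  exact ⟨n + 1, C', hC', rfl⟩

namespace IsPiecewiseMonotone

lemma arrow_iff (hf : IsPiecewiseMonotone f X) (hD : D ∈ domains f) :
    Arrow f D D' ↔ ∃ A ∈ cylinders f 1, (D ∩ A).Nonempty ∧ f^[1] '' (D ∩ A) = D' := by
  have himage : ∀ (C A : Set ℝ) (n : ℕ),
      f^[n + 1] '' (C ∩ f^[n] ⁻¹' A) = f^[1] '' (f^[n] '' C ∩ A) := fun C A n => by
    simpa only [univ_inter] using image_iterate_add_inter_preimage f n 1 univ C A
  constructor
  · rintro ⟨n, C, hC, C', hC', hsub, rfl, rfl⟩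
    obtain ⟨C₁, hC₁, A, hA, rfl⟩ := hf.exists_eq_inter_preimage hC'
    obtain ⟨z, hz⟩ := hC'.1
    obtain rfl : C₁ = C := eq_of_mem_cylinders hC₁ hC hz.1 (hsub hz)
    exact ⟨A, hA, ⟨f^[n] z, mem_image_of_mem _ hz.1, hz.2⟩, (himage C₁ A n).symm⟩
  · obtain ⟨n, C, hC, rfl⟩ := hD
    rintro ⟨A, hA, ⟨_, ⟨z, hz, rfl⟩, hzA⟩, rfl⟩
    exact ⟨n, C, hC, C ∩ f^[n] ⁻¹' A, hf.inter_preimage_mem_cylinders hC hA ⟨z, hz, hzA⟩,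
      inter_subset_left, rfl, (himage C A n).symm⟩

lemma exists_cylinder_of_hasPath (hf : IsPiecewiseMonotone f X) (hD : D ∈ domains f)
    (h : HasPath f n D D') :
    ∃ C ∈ cylinders f n, (D ∩ C).Nonempty ∧ f^[n] '' (D ∩ C) = D' := by
  obtain ⟨p, rfl, rfl, hp⟩ := h
  have hdom : ∀ k ≤ n, p k ∈ domains f := by
    rintro (- | k) hk
    exacts [hD, (hp k hk).mem_domains]
  induction n with
  | zero =>
    refine ⟨Ioo 0 1, Ioo_mem_cylinders_zero f, ?_⟩
    simp [inter_eq_left.2 (hf.subset_Ioo_of_mem_domains hD), nonempty_of_mem_domains hD]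
  | succ n ih =>
    obtain ⟨C, hC, -, himg⟩ := ih (fun k hk => hp k (by lia)) fun k hk => hdom k (by lia)
    obtain ⟨A, hA, hne, himg'⟩ :=
      (hf.arrow_iff (hdom n n.le_succ)).1 (hp n n.lt_succ_self)
    rw [← himg] at hne himg'
    obtain ⟨_, ⟨z, hz, rfl⟩, hzA⟩ := hne
    exact ⟨C ∩ f^[n] ⁻¹' A, hf.inter_preimage_mem_cylinders hC hA ⟨z, hz.2, hzA⟩,
      ⟨z, hz.1, hz.2, hzA⟩, by rw [image_iterate_add_inter_preimage, himg']⟩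

end IsPiecewiseMonotone

lemma IsTransitivePart.image_mem (hf : IsPiecewiseMonotone f X) (hE : IsTransitivePart f E)
    (hD : D ∈ E) (hC : C ∈ cylinders f n) (hne : (D ∩ C).Nonempty) :
    f^[n] '' (D ∩ C) ∈ E := by
  induction n generalizing C with
  | zero =>
    rw [eq_Ioo_of_mem_cylinders_zero hC,
      inter_eq_left.2 (hf.subset_Ioo_of_mem_domains (hE.subset hD)), Function.iterate_zero,
      image_id]
    exact hD
  | succ n ih =>
    obtain ⟨C₁, hC₁, A, hA, rfl⟩ := hf.exists_eq_inter_preimage hC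
    obtain ⟨z, hzD, hz, hzA⟩ := hne
    have hmem := ih hC₁ ⟨z, hzD, hz⟩
    rw [image_iterate_add_inter_preimage]
    exact hE.closed _ hmem _ ((hf.arrow_iff (hE.subset hmem)).2
      ⟨A, hA, ⟨_, mem_image_of_mem _ ⟨hzD, hz⟩, hzA⟩, rfl⟩)

/-- A piecewise monotone map with the two features of repelling, topologically mixing maps on which
the thermodynamic formalism of its tower rests: an interval that grows under an iterate is
eventually mapped over `(0,1)`, and no iterate traps a compact subinterval of `(0,1)`. -/
structure IsMixingPiecewiseMonotone (f : ℝ → ℝ) (X : Set ℝ) : Prop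
    extends IsPiecewiseMonotone f X where
  not_mapsTo_Icc : ∀ n ≥ 1, ∀ p q : ℝ, 0 < p → p < q → q < 1 → ¬ MapsTo f^[n] (Icc p q) (Icc p q)
  covers : ∀ D : Set ℝ, IsOpen D → D.OrdConnected → D.Nonempty → D ⊆ Ioo 0 1 →
    ∀ k ≥ 1, D ⊆ f^[k] '' D → ∃ N, Ioo 0 1 ⊆ f^[N] '' D

lemma IsTransitivePart.exists_Ioo_subset_image (hf : IsMixingPiecewiseMonotone f X)
    (hE : IsTransitivePart f E) (hD : D ∈ E) : ∃ N, Ioo 0 1 ⊆ f^[N] '' D := by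
  have hdom := hE.subset hD
  obtain ⟨k, hpath, hk⟩ := ((hE.primitive D hD D hD).and (eventually_ge_atTop 1)).exists
  obtain ⟨C, -, -, himg⟩ := hf.exists_cylinder_of_hasPath hdom hpath
  refine hf.covers D (isOpen_of_mem_domains hdom) (ordConnected_of_mem_domains hdom)
    (nonempty_of_mem_domains hdom) (hf.subset_Ioo_of_mem_domains hdom) k hk ?_
  calc D = f^[k] '' (D ∩ C) := himg.symm
    _ ⊆ f^[k] '' D := image_mono inter_subset_left

end Tower

/-! ### Partition sums -/

/-- The weights `exp r` of the partition sums, with values in `[0, ∞]`. -/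
def expE (r : ℝ) : ENNReal := ENNReal.ofReal (Real.exp r)

/-- The weight `sup_C exp φₙ` of a cylinder `C` of order `n`. -/
def cylWeight (f φ : ℝ → ℝ) (n : ℕ) (C : Set ℝ) : ENNReal :=
  ⨆ x ∈ C, expE (birkhoffSum f φ n x)

/-- The cylinders of order `n` that meet `D`. -/
def cylindersMeeting (f : ℝ → ℝ) (n : ℕ) (D : Set ℝ) : Set (Set ℝ) :=
  {C ∈ cylinders f n | (D ∩ C).Nonempty}

/-- The part of the partition sum of order `n` carried by the cylinders in `𝒞`. -/
def weightSum (f φ : ℝ → ℝ) (n : ℕ) (𝒞 : Set (Set ℝ)) : ENNReal :=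
  ∑' C : 𝒞, cylWeight f φ n C

lemma tsum_le_tsum_of_relation {α β : Type*} {u : α → ENNReal} {v : β → ENNReal}
    (R : α → β → Prop) (h : ∀ i, ∃ j, R i j ∧ u i ≤ v j)
    (hR : ∀ i i' j, R i j → R i' j → i = i') : ∑' i, u i ≤ ∑' j, v j := by
  choose r hr huv using h
  have hinj : Function.Injective r := fun i i' hii' => hR i i' (r i) (hr i) (hii' ▸ hr i')
  exact (ENNReal.tsum_le_tsum huv).trans (ENNReal.tsum_comp_le_tsum_of_injective hinj v)

section BirkhoffSum

variable {α : Type*} {f : α → α} {φ : α → ℝ} {s : Set α} {a b : ℝ} {x : α}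

lemma natCast_mul_le_birkhoffSum (hf : MapsTo f s s) (ha : ∀ x ∈ s, a ≤ φ x) (hx : x ∈ s) (n : ℕ) :
    n * a ≤ birkhoffSum f φ n x := by
  simpa [birkhoffSum] using Finset.card_nsmul_le_sum (Finset.range n) (fun k => φ (f^[k] x)) a
    fun k _ => ha _ (hf.iterate k hx)

lemma birkhoffSum_le_natCast_mul (hf : MapsTo f s s) (hb : ∀ x ∈ s, φ x ≤ b) (hx : x ∈ s) (n : ℕ) :
    birkhoffSum f φ n x ≤ n * b := by
  simpa [birkhoffSum] using Finset.sum_le_card_nsmul (Finset.range n) (fun k => φ (f^[k] x)) b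
    fun k _ => hb _ (hf.iterate k hx)

end BirkhoffSum

section PartitionSums

variable {f φ : ℝ → ℝ} {X C D : Set ℝ} {𝒞 : Set (Set ℝ)} {n m : ℕ} {x y a b : ℝ}

lemma expE_add (r s : ℝ) : expE (r + s) = expE r * expE s := by
  rw [expE, Real.exp_add, ENNReal.ofReal_mul (Real.exp_pos r).le, ← expE, ← expE]

lemma expE_mono : Monotone expE := fun _ _ h => ENNReal.ofReal_le_ofReal (Real.exp_le_exp.2 h)

lemma expE_ne_zero (r : ℝ) : expE r ≠ 0 := (ENNReal.ofReal_pos.2 (Real.exp_pos r)).ne'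

lemma expE_ne_top (r : ℝ) : expE r ≠ ⊤ := ENNReal.ofReal_ne_top

lemma le_cylWeight (hx : x ∈ C) : expE (birkhoffSum f φ n x) ≤ cylWeight f φ n C :=
  le_iSup₂_of_le x hx le_rfl

lemma cylWeight_inter_preimage_le (C C' : Set ℝ) :
    cylWeight f φ (n + m) (C ∩ f^[n] ⁻¹' C') ≤ cylWeight f φ n C * cylWeight f φ m C' := by
  refine iSup₂_le fun x hx => ?_
  rw [birkhoffSum_add, expE_add]
  exact mul_le_mul' (le_cylWeight hx.1) (le_cylWeight hx.2)

lemma topSum_eq_weightSum (f φ : ℝ → ℝ) (n : ℕ) :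
    topSum f φ n = weightSum f φ n (cylinders f n) := rfl

lemma weightSum_le_topSum (h : 𝒞 ⊆ cylinders f n) : weightSum f φ n 𝒞 ≤ topSum f φ n :=
  ENNReal.tsum_mono_subtype (cylWeight f φ n) h

namespace IsPiecewiseMonotone

lemma exists_mem_cylindersMeeting (hf : IsPiecewiseMonotone f X) (hD : D.Infinite)
    (hsub : D ⊆ Ioo 0 1) (n : ℕ) : (cylindersMeeting f n D).Nonempty := by
  obtain ⟨x, hx, hx'⟩ := hD.exists_notMem_finite (hf.finite_exceptional_iterate n)
  obtain ⟨C, hC, hxC⟩ := exists_mem_cylinders (f := f) (n := n) (hsub hx) fun i hi => by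
    by_contra h
    exact hx' ⟨hf.Ioo_subset (hsub hx), i, hi, h⟩
  exact ⟨C, hC, x, hx, hxC⟩

lemma ncard_cylinders_pos (hf : IsPiecewiseMonotone f X) (n : ℕ) : 0 < (cylinders f n).ncard := by
  obtain ⟨C, hC, -⟩ := hf.exists_mem_cylindersMeeting (Ioo_infinite one_pos) subset_rfl n
  exact (ncard_pos (hf.finite_cylinders n)).2 ⟨C, hC⟩

lemma mem_of_mem_cylinders (hf : IsPiecewiseMonotone f X) (hC : C ∈ cylinders f n) (hx : x ∈ C) :
    x ∈ X :=
  hf.Ioo_subset (subset_Ioo_of_mem_cylinders hC hx)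

lemma cylWeight_le_expE (hf : IsPiecewiseMonotone f X) (hb : ∀ x ∈ X, φ x ≤ b)
    (hC : C ∈ cylinders f n) : cylWeight f φ n C ≤ expE (n * b) :=
  iSup₂_le fun _ hx =>
    expE_mono (birkhoffSum_le_natCast_mul hf.mapsTo hb (hf.mem_of_mem_cylinders hC hx) n)

lemma expE_le_cylWeight (hf : IsPiecewiseMonotone f X) (ha : ∀ x ∈ X, a ≤ φ x)
    (hC : C ∈ cylinders f n) : expE (n * a) ≤ cylWeight f φ n C := by
  obtain ⟨x, hx⟩ := hC.1
  exact (expE_mono (natCast_mul_le_birkhoffSum hf.mapsTo ha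
    (hf.mem_of_mem_cylinders hC hx) n)).trans (le_cylWeight hx)

lemma abs_birkhoffSum_sub_le_beta (hf : IsPiecewiseMonotone f X) (hφ : MapsTo φ X (Icc a b))
    (hC : C ∈ cylinders f n) (hx : x ∈ C) (hy : y ∈ C) :
    |birkhoffSum f φ n x - birkhoffSum f φ n y| ≤ beta f φ n := by
  refine le_csSup ⟨n * b - n * a, ?_⟩ ⟨C, hC, x, hx, y, hy, rfl⟩
  rintro _ ⟨C, hC, x, hx, y, hy, rfl⟩
  have hmem : ∀ z ∈ C, birkhoffSum f φ n z ∈ Icc (n * a) (n * b) := fun z hz =>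
    have hzX := hf.mem_of_mem_cylinders hC hz
    ⟨natCast_mul_le_birkhoffSum hf.mapsTo (fun w hw => (hφ hw).1) hzX n,
      birkhoffSum_le_natCast_mul hf.mapsTo (fun w hw => (hφ hw).2) hzX n⟩
  exact abs_sub_le_of_le_of_le (hmem x hx).1 (hmem x hx).2 (hmem y hy).1 (hmem y hy).2

lemma expE_mul_cylWeight_le (hf : IsPiecewiseMonotone f X) (hφ : MapsTo φ X (Icc a b))
    (hC : C ∈ cylinders f m) (p q : ℕ) (hx : x ∈ X) (hxC : f^[p] x ∈ C) :
    expE (((p + q : ℕ) : ℝ) * a - beta f φ m) * cylWeight f φ m C ≤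
      expE (birkhoffSum f φ (p + m + q) x) := by
  have hlower : ∀ {z}, z ∈ X → ∀ i : ℕ, i * a ≤ birkhoffSum f φ i z := fun hz i =>
    natCast_mul_le_birkhoffSum hf.mapsTo (fun w hw => (hφ hw).1) hz i
  have hweight : cylWeight f φ m C ≤ expE (birkhoffSum f φ m (f^[p] x) + beta f φ m) :=
    iSup₂_le fun y hy => expE_mono (by
      linarith [le_of_abs_le (hf.abs_birkhoffSum_sub_le_beta hφ hC hy hxC)])
  calc expE (((p + q : ℕ) : ℝ) * a - beta f φ m) * cylWeight f φ m C
      ≤ expE (((p + q : ℕ) : ℝ) * a - beta f φ m) *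
          expE (birkhoffSum f φ m (f^[p] x) + beta f φ m) := by gcongr
    _ = expE (p * a + birkhoffSum f φ m (f^[p] x) + q * a) := by
      rw [← expE_add]
      push_cast
      ring_nf
    _ ≤ expE (birkhoffSum f φ (p + m + q) x) := by
      rw [birkhoffSum_add, birkhoffSum_add]
      exact expE_mono (by
        linarith [hlower hx p, hlower (hf.mapsTo.iterate (p + m) hx) q])

lemma tsum_cylinders_const (hf : IsPiecewiseMonotone f X) (n : ℕ) (c : ENNReal) :
    ∑' _ : cylinders f n, c = (cylinders f n).ncard * c := by
  rw [ENNReal.tsum_const, ← Set.encard, ← (hf.finite_cylinders n).cast_ncard_eq]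
  rfl

lemma topSum_le (hf : IsPiecewiseMonotone f X) (hb : ∀ x ∈ X, φ x ≤ b) (n : ℕ) :
    topSum f φ n ≤ (cylinders f n).ncard * expE (n * b) := by
  rw [← hf.tsum_cylinders_const]
  exact ENNReal.tsum_le_tsum fun C => hf.cylWeight_le_expE hb C.2

lemma le_topSum (hf : IsPiecewiseMonotone f X) (ha : ∀ x ∈ X, a ≤ φ x) (n : ℕ) :
    (cylinders f n).ncard * expE (n * a) ≤ topSum f φ n := by
  rw [← hf.tsum_cylinders_const]
  exact ENNReal.tsum_le_tsum fun C => hf.expE_le_cylWeight ha C.2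

lemma topSum_ne_top (hf : IsPiecewiseMonotone f X) (hb : ∀ x ∈ X, φ x ≤ b) (n : ℕ) :
    topSum f φ n ≠ ⊤ :=
  ne_top_of_le_ne_top (ENNReal.mul_ne_top (ENNReal.natCast_ne_top _) (expE_ne_top _))
    (hf.topSum_le hb n)

lemma expE_le_topSum (hf : IsPiecewiseMonotone f X) (ha : ∀ x ∈ X, a ≤ φ x) (n : ℕ) :
    expE (n * a) ≤ topSum f φ n :=
  (le_mul_of_one_le_left' (Nat.one_le_cast.2 (hf.ncard_cylinders_pos n))).trans (hf.le_topSum ha n)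

lemma topSum_add_le (hf : IsPiecewiseMonotone f X) (n m : ℕ) :
    topSum f φ (n + m) ≤ topSum f φ n * topSum f φ m := by
  have hprod : topSum f φ n * topSum f φ m =
      ∑' p : cylinders f n × cylinders f m, cylWeight f φ n p.1 * cylWeight f φ m p.2 := by
    rw [ENNReal.tsum_prod (f := fun (A : cylinders f n) (B : cylinders f m) =>
      cylWeight f φ n A * cylWeight f φ m B)]
    simp only [topSum_eq_weightSum, weightSum, ENNReal.tsum_mul_left, ENNReal.tsum_mul_right]
  rw [hprod]
  refine tsum_le_tsum_of_relation
    (fun C p => (C : Set ℝ) = (p.1 : Set ℝ) ∩ f^[n] ⁻¹' p.2) ?_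
    fun C C' p h h' => Subtype.ext (h.trans h'.symm)
  rintro ⟨C, hC⟩
  obtain ⟨C₁, hC₁, C₂, hC₂, rfl⟩ := hf.exists_eq_inter_preimage hC
  exact ⟨(⟨C₁, hC₁⟩, ⟨C₂, hC₂⟩), rfl, cylWeight_inter_preimage_le C₁ C₂⟩

end IsPiecewiseMonotone

end PartitionSums

/-! ### Comparison of partition sums -/

section Comparison

variable {f φ : ℝ → ℝ} {X A C D S W : Set ℝ} {𝒞 : Set (Set ℝ)} {n m k l K N R : ℕ}
  {x y u v a b : ℝ}

lemma IsMixingPiecewiseMonotone.eq_of_iterate_eq_self (hf : IsMixingPiecewiseMonotone f X)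
    (hn : 1 ≤ n) (hC : C ∈ cylinders f n) (hx : x ∈ C) (hy : y ∈ C) (hfx : f^[n] x = x)
    (hfy : f^[n] y = y) : x = y := by
  wlog hxy : x ≤ y generalizing x y
  · exact (this hy hx hfy hfx (le_of_not_ge hxy)).symm
  refine hxy.eq_of_not_lt fun hlt => ?_
  have hsub := subset_Ioo_of_mem_cylinders hC
  rcases (isMonotoneInterval_iterate hC le_rfl).strict with hmono | hanti
  · refine hf.not_mapsTo_Icc n hn x y (hsub hx).1 hlt (hsub hy).2 fun z hz => ?_
    have hzC := (ordConnected_of_mem_cylinders hC).out hx hy hz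
    exact ⟨hfx ▸ hmono.monotoneOn hx hzC hz.1, hfy ▸ hmono.monotoneOn hzC hy hz.2⟩
  · have hgt := hanti hx hy hlt
    rw [hfx, hfy] at hgt
    exact hgt.not_gt hlt

lemma IsMixingPiecewiseMonotone.hatZ_le_topSum (hf : IsMixingPiecewiseMonotone f X)
    (hD : D ⊆ Ioo 0 1) (hS : S ⊆ D) (hn : 1 ≤ n) :
    hatZ f φ (S ×ˢ {D}) n ≤ topSum f φ n := by
  refine tsum_le_tsum_of_relation (fun p A => p.1.1 ∈ (A : Set ℝ)) ?_ ?_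
  · rintro ⟨⟨x, _⟩, ⟨hx, rfl⟩, hper⟩
    obtain ⟨A, hA, hxA⟩ := exists_mem_cylinders_of_hatMap_iterate_eq (hS hx) hD hper
    exact ⟨⟨A, hA⟩, hxA, by rw [birkhoffSum_hatMap]; exact le_cylWeight hxA⟩
  · rintro ⟨p, hp, hpper⟩ ⟨q, hq, hqper⟩ A hpA hqA
    have hfix : ∀ {z : ℝ × Set ℝ}, (hatMap f)^[n] z = z → f^[n] z.1 = z.1 := fun {z} hz => by
      rw [← hatMap_iterate_fst, hz]
    have hfst := hf.eq_of_iterate_eq_self hn A.2 hpA hqA (hfix hpper) (hfix hqper)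
    exact Subtype.ext (Prod.ext hfst (hp.2.trans hq.2.symm))

lemma hatTopSum_le_topSum (S D : Set ℝ) (n : ℕ) :
    hatTopSum f φ (S ×ˢ {D}) n ≤ topSum f φ n := by
  refine tsum_le_tsum_of_relation (fun J A => (J : Set (ℝ × Set ℝ)) = (D ∩ A) ×ˢ {D}) ?_
    fun J J' A h h' => Subtype.ext (h.trans h'.symm)
  rintro ⟨_, ⟨D', -, A, hA, ⟨x, hx⟩, rfl⟩, hsub⟩
  obtain rfl : D' = D := (hsub (mk_mem_prod hx rfl)).2
  refine ⟨⟨A, hA⟩, rfl, iSup₂_le fun p hp => ?_⟩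
  rw [birkhoffSum_hatMap]
  exact le_cylWeight hp.1.2

namespace IsPiecewiseMonotone

lemma le_hatTopSum (hf : IsPiecewiseMonotone f X) (hφ : MapsTo φ X (Icc a b)) (hD : D ∈ domains f)
    (hC : C ∈ cylinders f k) (m : ℕ) :
    expE (k * a - beta f φ m) * weightSum f φ m (cylindersMeeting f m (f^[k] '' (D ∩ C))) ≤
      hatTopSum f φ ((D ∩ C) ×ˢ {D}) (k + m) := by
  rw [weightSum, ← ENNReal.tsum_mul_left]
  refine tsum_le_tsum_of_relation
    (fun A J => (J : Set (ℝ × Set ℝ)) ⊆ Prod.fst ⁻¹' (f^[k] ⁻¹' A)) ?_ ?_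
  · rintro ⟨A, hA, _, ⟨x, hx, rfl⟩, hxA⟩
    have hCA := hf.inter_preimage_mem_cylinders hC hA ⟨x, hx.2, hxA⟩
    refine ⟨⟨(D ∩ (C ∩ f^[k] ⁻¹' A)) ×ˢ {D}, ⟨D, hD, _, hCA, ⟨x, hx.1, hx.2, hxA⟩, rfl⟩,
      prod_mono_left (inter_subset_inter_right _ inter_subset_left)⟩, fun p hp => hp.1.2.2,
      le_iSup₂_of_le (x, D) ⟨⟨hx.1, hx.2, hxA⟩, rfl⟩ ?_⟩
    rw [birkhoffSum_hatMap]
    exact hf.expE_mul_cylWeight_le hφ hA k 0 (hf.mem_of_mem_cylinders hC hx.2) hxA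
  · rintro ⟨A, hA, _⟩ ⟨B, hB, _⟩ ⟨_, ⟨D', _, C', _, ⟨x, hx⟩, rfl⟩, _⟩ hJA hJB
    have hmem : (x, D') ∈ (D' ∩ C') ×ˢ {D'} := mk_mem_prod hx rfl
    exact Subtype.ext (eq_of_mem_cylinders hA hB (hJA hmem) (hJB hmem))

lemma exists_mem_cylinders_inter_preimage (hf : IsPiecewiseMonotone f X) (hD : D ⊆ Ioo 0 1)
    (hN : Ioo 0 1 ⊆ f^[N] '' D) (hC : C ∈ cylinders f m) :
    ∃ B ∈ cylindersMeeting f (N + m) D, B ⊆ f^[N] ⁻¹' C := by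
  have hinf : (D ∩ f^[N] ⁻¹' C).Infinite := by
    refine .of_image f^[N] ?_
    rw [image_inter_preimage, inter_eq_right.2 ((subset_Ioo_of_mem_cylinders hC).trans hN)]
    obtain ⟨x, hx⟩ := hC.1
    exact infinite_of_mem_nhds x ((isOpen_of_mem_cylinders hC).mem_nhds hx)
  obtain ⟨A, hA, x, hx, hxA⟩ :=
    hf.exists_mem_cylindersMeeting hinf (inter_subset_left.trans hD) N
  exact ⟨A ∩ f^[N] ⁻¹' C, ⟨hf.inter_preimage_mem_cylinders hA hC ⟨x, hxA, hx.2⟩,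
    x, hx.1, hxA, hx.2⟩, inter_subset_right⟩

lemma le_weightSum_cylindersMeeting (hf : IsPiecewiseMonotone f X) (hφ : MapsTo φ X (Icc a b))
    (hD : D ⊆ Ioo 0 1) (hN : Ioo 0 1 ⊆ f^[N] '' D) (m : ℕ) :
    expE (N * a - beta f φ m) * topSum f φ m ≤
      weightSum f φ (N + m) (cylindersMeeting f (N + m) D) := by
  rw [topSum_eq_weightSum, weightSum, ← ENNReal.tsum_mul_left]
  refine tsum_le_tsum_of_relation (fun C B => (B : Set ℝ) ⊆ f^[N] ⁻¹' C) ?_ ?_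
  · rintro ⟨C, hC⟩
    obtain ⟨B, hB, hBC⟩ := hf.exists_mem_cylinders_inter_preimage hD hN hC
    obtain ⟨x, hx⟩ := hB.1.1
    exact ⟨⟨B, hB⟩, hBC, (hf.expE_mul_cylWeight_le hφ hC N 0
      (hf.mem_of_mem_cylinders hB.1 hx) (hBC hx)).trans (le_cylWeight hx)⟩
  · rintro ⟨C, hC⟩ ⟨C', hC'⟩ ⟨B, hB⟩ hBC hBC'
    obtain ⟨x, hx⟩ := hB.1.1
    exact Subtype.ext (eq_of_mem_cylinders hC hC' (hBC hx) (hBC' hx))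

end IsPiecewiseMonotone

lemma csInf_mem_or_csSup_mem_of_not_subset {α : Type*} [ConditionallyCompleteLinearOrder α]
    {s t : Set α} (hs : s.OrdConnected) (habove : BddAbove s) (hbelow : BddBelow s)
    (ht : t.OrdConnected) (hne : (s ∩ t).Nonempty) (hts : ¬ t ⊆ s) : sInf s ∈ t ∨ sSup s ∈ t := by
  obtain ⟨x, hxs, hxt⟩ := hne
  obtain ⟨y, hyt, hys⟩ := not_subset.1 hts
  rcases le_total y x with hyx | hxy
  · refine .inl (ht.out hyt hxt ⟨le_csInf ⟨x, hxs⟩ fun z hz => ?_, csInf_le hbelow hxs⟩)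
    by_contra! hzy
    exact hys (hs.out hz hxs ⟨hzy.le, hyx⟩)
  · refine .inr (ht.out hxt hyt ⟨le_csSup habove hxs, csSup_le ⟨x, hxs⟩ fun z hz => ?_⟩)
    by_contra! hzy
    exact hys (hs.out hxs hz ⟨hxy, hzy.le⟩)

/-- The cylinders `C` of order `n` for which the path of domains from `D` along `C` ends in one of
the finitely many domains `f^R(A)` of cylinders `A` of order `R`. -/
def cylindersReturning (f : ℝ → ℝ) (n R : ℕ) (D : Set ℝ) : Set (Set ℝ) :=
  {C ∈ cylindersMeeting f n D | ∃ A ∈ cylinders f R, f^[n] '' (D ∩ C) = f^[R] '' A}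

namespace IsPiecewiseMonotone

lemma weightSum_through_le (hf : IsPiecewiseMonotone f X) (hb : ∀ x ∈ X, φ x ≤ b)
    (𝒞 : Set (Set ℝ)) (z : Set ℝ → ℝ) (n R : ℕ) :
    weightSum f φ (n + R) {B | ∃ C ∈ 𝒞, ∃ A ∈ cylinders f R, z C ∈ A ∧ B = C ∩ f^[n] ⁻¹' A} ≤
      expE (R * b) * weightSum f φ n 𝒞 := by
  rw [weightSum, weightSum, ← ENNReal.tsum_mul_left]
  refine tsum_le_tsum_of_relation
    (fun B C => ∃ A ∈ cylinders f R, z C ∈ A ∧ (B : Set ℝ) = (C : Set ℝ) ∩ f^[n] ⁻¹' A) ?_ ?_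
  · rintro ⟨_, C, hC, A, hA, hz, rfl⟩
    refine ⟨⟨C, hC⟩, ⟨A, hA, hz, rfl⟩, ?_⟩
    rw [mul_comm]
    exact (cylWeight_inter_preimage_le C A).trans (by gcongr; exact hf.cylWeight_le_expE hb hA)
  · rintro B B' C ⟨A, hA, hz, hB⟩ ⟨A', hA', hz', hB'⟩
    obtain rfl := eq_of_mem_cylinders hA hA' hz hz'
    exact Subtype.ext (hB.trans hB'.symm)

/-- All but two of the cylinders of order `R` meeting the interval `fⁿ(D ∩ C)` are contained in
it, and those give rise to returning cylinders. -/
lemma weightSum_cylindersMeeting_add_le (hf : IsPiecewiseMonotone f X) (hb : ∀ x ∈ X, φ x ≤ b)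
    (hD : IsOpen D) (hDoc : D.OrdConnected) (n R : ℕ) :
    weightSum f φ (n + R) (cylindersMeeting f (n + R) D) ≤
      2 * expE (R * b) * weightSum f φ n (cylindersMeeting f n D) +
        weightSum f φ (n + R) (cylindersReturning f (n + R) R D) := by
  let through (z : Set ℝ → ℝ) : Set (Set ℝ) :=
    {B | ∃ C ∈ cylindersMeeting f n D, ∃ A ∈ cylinders f R, z C ∈ A ∧ B = C ∩ f^[n] ⁻¹' A}
  have hcover : cylindersMeeting f (n + R) D ⊆
      through (fun C => sInf (f^[n] '' (D ∩ C))) ∪ through (fun C => sSup (f^[n] '' (D ∩ C))) ∪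
        cylindersReturning f (n + R) R D := by
    rintro B ⟨hB, hne⟩
    obtain ⟨C, hC, A, hA, rfl⟩ := hf.exists_eq_inter_preimage hB
    obtain ⟨x, hxD, hxC, hxA⟩ := id hne
    by_cases hsub : A ⊆ f^[n] '' (D ∩ C)
    · refine .inr ⟨⟨hB, hne⟩, A, hA, ?_⟩
      rw [image_iterate_add_inter_preimage, inter_eq_right.2 hsub]
    have hmono := (isMonotoneInterval_iterate hC le_rfl).mono
      (hD.inter (isOpen_of_mem_cylinders hC)) ⟨x, hxD, hxC⟩
      (hDoc.inter (ordConnected_of_mem_cylinders hC)) inter_subset_right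
    have himg : f^[n] '' (D ∩ C) ⊆ Ioo 0 1 :=
      (image_mono inter_subset_right).trans (hf.image_subset_Ioo hC)
    exact .inl ((csInf_mem_or_csSup_mem_of_not_subset hmono.ordConnected_image
      (bddAbove_Ioo.mono himg) (bddBelow_Ioo.mono himg) (ordConnected_of_mem_cylinders hA)
      ⟨_, mem_image_of_mem _ ⟨hxD, hxC⟩, hxA⟩ hsub).imp
      (fun h => ⟨C, ⟨hC, x, hxD, hxC⟩, A, hA, h, rfl⟩)
      fun h => ⟨C, ⟨hC, x, hxD, hxC⟩, A, hA, h, rfl⟩)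
  calc weightSum f φ (n + R) (cylindersMeeting f (n + R) D)
      ≤ weightSum f φ (n + R) (through _) + weightSum f φ (n + R) (through _) +
          weightSum f φ (n + R) (cylindersReturning f (n + R) R D) :=
        (ENNReal.tsum_mono_subtype _ hcover).trans <| (ENNReal.tsum_union_le _ _ _).trans <|
          add_le_add_left (ENNReal.tsum_union_le _ _ _) _
    _ ≤ expE (R * b) * weightSum f φ n (cylindersMeeting f n D) +
          expE (R * b) * weightSum f φ n (cylindersMeeting f n D) +
          weightSum f φ (n + R) (cylindersReturning f (n + R) R D) := by
        gcongr <;> exact hf.weightSum_through_le hb _ _ _ _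
    _ = _ := by ring

end IsPiecewiseMonotone

lemma exists_hatMap_iterate_eq (hD : D ⊆ Ioo 0 1) (hW : W ∈ cylinders f n) (hWuv : W ⊆ Icc u v)
    (huv : Icc u v ⊆ D) (himg : f^[n] '' (D ∩ W) = D) :
    ∃ x ∈ W, (hatMap f)^[n] (x, D) = (x, D) := by
  obtain ⟨w, hw⟩ := hW.1
  have hle : u ≤ v := (hWuv hw).1.trans (hWuv hw).2
  obtain ⟨s, hs, hsu⟩ := himg.superset (huv (left_mem_Icc.2 hle))
  obtain ⟨t, ht, htv⟩ := himg.superset (huv (right_mem_Icc.2 hle))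
  obtain ⟨x, hx, hfx⟩ := (ordConnected_of_mem_cylinders hW).isPreconnected.intermediate_value₂
    hs.2 ht.2 (isMonotoneInterval_iterate hW le_rfl).continuousOn continuousOn_id
    (hsu.trans_le (hWuv hs.2).1) ((hWuv ht.2).2.trans htv.ge)
  exact ⟨x, hx, by rw [hatMap_iterate_of_mem hW hx hD, himg, hfx, id]⟩

/-- Paths that start in `A`, deep inside `S`, and end in `D` close up to periodic points. -/
lemma IsPiecewiseMonotone.le_hatZ (hf : IsPiecewiseMonotone f X) (hφ : MapsTo φ X (Icc a b))
    (hD : D ⊆ Ioo 0 1) (hS : S ⊆ D) (hA : A ∈ cylinders f K) (hAuv : A ⊆ Icc u v)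
    (huv : Icc u v ⊆ S) (h𝒞 : 𝒞 ⊆ cylindersMeeting f n (f^[K] '' A))
    (hpath : ∀ B ∈ 𝒞, HasPath f l (f^[n] '' (f^[K] '' A ∩ B)) D) :
    expE ((K + l : ℕ) * a - beta f φ n) * weightSum f φ n 𝒞 ≤ hatZ f φ (S ×ˢ {D}) (K + n + l) := by
  rw [weightSum, ← ENNReal.tsum_mul_left]
  have hAD : D ∩ A = A := inter_eq_right.2 (hAuv.trans (huv.trans hS))
  refine tsum_le_tsum_of_relation (fun B p => f^[K] p.1.1 ∈ (B : Set ℝ)) ?_ fun B B' p h h' =>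
    Subtype.ext (eq_of_mem_cylinders (h𝒞 B.2).1 (h𝒞 B'.2).1 h h')
  rintro ⟨B, hB⟩
  obtain ⟨hBcyl, _, ⟨z, hzA, rfl⟩, hzB⟩ := h𝒞 hB
  have hAB := hf.inter_preimage_mem_cylinders hA hBcyl ⟨z, hzA, hzB⟩
  have himg : f^[K + n] '' (D ∩ (A ∩ f^[K] ⁻¹' B)) = f^[n] '' (f^[K] '' A ∩ B) := by
    rw [image_iterate_add_inter_preimage, hAD]
  have hdom : f^[n] '' (f^[K] '' A ∩ B) ∈ domains f := by
    refine ⟨K + n, A ∩ f^[K] ⁻¹' B, hAB, ?_⟩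
    rw [← himg, ← inter_assoc, hAD]
  obtain ⟨T, hT, hne, hTimg⟩ := hf.exists_cylinder_of_hasPath hdom (hpath B hB)
  rw [← himg] at hne hTimg
  obtain ⟨_, ⟨w, hw, rfl⟩, hwT⟩ := hne
  obtain ⟨x, hx, hper⟩ := exists_hatMap_iterate_eq hD
    (hf.inter_preimage_mem_cylinders hAB hT ⟨w, hw.2, hwT⟩)
    (fun y hy => hAuv hy.1.1) (huv.trans hS) (by rw [image_iterate_add_inter_preimage, hTimg])
  refine ⟨⟨(x, D), ⟨huv (hAuv hx.1.1), rfl⟩, hper⟩, hx.1.2, ?_⟩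
  rw [birkhoffSum_hatMap]
  exact hf.expE_mul_cylWeight_le hφ hBcyl K l (hf.mem_of_mem_cylinders hA hx.1.1) hx.1.2

end Comparison

/-! ### Exponential growth -/

section ExpGrowth

open ExpGrowth

variable {s t r : ℕ → ENNReal} {β : ℕ → ℝ} {a c d : ℝ}

lemma expE_natCast_mul (n : ℕ) (c : ℝ) : expE (n * c) = EReal.exp (c * n) := by
  rw [← EReal.coe_coe_eq_natCast, ← EReal.coe_mul, EReal.exp_coe, mul_comm, expE]

lemma expGrowthInf_expE (c : ℝ) : expGrowthInf (fun n => expE (n * c)) = c := by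
  simp only [expE_natCast_mul, expGrowthInf_exp]

lemma expGrowthSup_expE (c : ℝ) : expGrowthSup (fun n => expE (n * c)) = c := by
  simp only [expE_natCast_mul, expGrowthSup_exp]

lemma exists_tendsto_log_div_of_submultiplicative (hsub : ∀ n m, s (n + m) ≤ s n * s m)
    (htop : ∀ n, s n ≠ ⊤) (ha : ∀ n : ℕ, expE (n * a) ≤ s n) :
    ∃ P : ℝ, Tendsto (fun n : ℕ => ENNReal.log (s n) / n) atTop (𝓝 (P : EReal)) := by
  have hne : ∀ n, s n ≠ 0 := fun n => ((expE_ne_zero _).bot_lt.trans_le (ha n)).ne'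
  have hpos : ∀ n, 0 < (s n).toReal := fun n => ENNReal.toReal_pos (hne n) (htop n)
  set u : ℕ → ℝ := fun n => Real.log (s n).toReal
  have hu : Subadditive u := fun n m => by
    rw [← Real.log_mul (hpos n).ne' (hpos m).ne', ← ENNReal.toReal_mul]
    exact Real.log_le_log (hpos _)
      (ENNReal.toReal_mono (ENNReal.mul_ne_top (htop n) (htop m)) (hsub n m))
  have hau : ∀ n : ℕ, n * a ≤ u n := fun n =>
    (Real.le_log_iff_exp_le (hpos n)).2 ((ENNReal.ofReal_le_iff_le_toReal (htop n)).1 (ha n))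
  have hbdd : BddBelow (range fun n => u n / n) := by
    refine ⟨min a 0, ?_⟩
    rintro _ ⟨n, rfl⟩
    rcases n.eq_zero_or_pos with rfl | hn
    · simp
    · exact (min_le_left _ _).trans ((le_div_iff₀ (by positivity)).2 (by linarith [hau n]))
  refine ⟨hu.lim, ((continuous_coe_real_ereal.tendsto _).comp (hu.tendsto_lim hbdd)).congr
    fun n => ?_⟩
  rw [ENNReal.log_pos_real (hne n) (htop n), Function.comp_apply, EReal.coe_div]
  rfl

lemma eventually_expE_le_of_lt (hβ : β =o[atTop] fun n : ℕ => (n : ℝ)) (hac : a < c) (d : ℝ)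
    (k : ℕ) : ∀ᶠ m : ℕ in atTop, expE ((k + m : ℕ) * a) ≤ expE (d - β m) * expE (m * c) := by
  have hδ : 0 < (c - a) / 2 := by linarith
  filter_upwards [hβ.bound hδ, tendsto_natCast_atTop_atTop.eventually_ge_atTop
    ((k * a - d) / ((c - a) / 2))] with m hβm hm
  rw [← expE_add]
  rw [Real.norm_eq_abs, Real.norm_natCast] at hβm
  rw [div_le_iff₀ hδ] at hm
  refine expE_mono ?_
  push_cast
  linarith [le_of_abs_le hβm]

section Shift

variable {k : ℕ} (hβ : β =o[atTop] fun n : ℕ => (n : ℝ))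
  (h : ∀ m, expE (d - β m) * t m ≤ s (k + m))
include hβ h

lemma expGrowthInf_le_of_shift : expGrowthInf t ≤ expGrowthInf s := by
  refine EReal.ge_of_forall_gt_iff_ge.1 fun a ha => ?_
  obtain ⟨c, hac, hc⟩ := EReal.lt_iff_exists_real_btwn.1 ha
  refine Eventually.le_expGrowthInf ?_
  rw [← map_add_atTop_eq_nat k, eventually_map]
  filter_upwards [eventually_expE_le_of_lt hβ (EReal.coe_lt_coe_iff.1 hac) d k,
    eventually_exp_le hc] with m hm htm
  rw [← expE_natCast_mul, add_comm]
  rw [← expE_natCast_mul] at htm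
  exact (hm.trans (by gcongr)).trans (h m)

lemma expGrowthSup_le_of_shift : expGrowthSup t ≤ expGrowthSup s := by
  refine EReal.ge_of_forall_gt_iff_ge.1 fun a ha => ?_
  obtain ⟨c, hac, hc⟩ := EReal.lt_iff_exists_real_btwn.1 ha
  refine Frequently.le_expGrowthSup ?_
  rw [← map_add_atTop_eq_nat k, frequently_map]
  refine ((eventually_expE_le_of_lt hβ (EReal.coe_lt_coe_iff.1 hac) d k).and_frequently
    (frequently_exp_le hc)).mono fun m hm => ?_
  rw [← expE_natCast_mul, add_comm]
  rw [← expE_natCast_mul] at hm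
  exact (hm.1.trans (by gcongr; exact hm.2)).trans (h m)

end Shift

lemma exists_forall_le_of_contracting {θ : ENNReal} {R : ℕ} (ht : ∀ n, t n ≠ ⊤) (hR : 0 < R)
    (hθ : θ < 1) (h : ∀ᶠ n in atTop, t (n + R) ≤ θ * t n + 1) : ∃ B ≠ ⊤, ∀ n, t n ≤ B := by
  obtain ⟨n₀, hn₀⟩ := eventually_atTop.1 h
  set B := ∑ i ∈ Finset.range (n₀ + R), t i + (1 - θ)⁻¹
  have hθ' : 1 - θ ≠ 0 := (tsub_pos_of_lt hθ).ne'
  refine ⟨B, ENNReal.add_ne_top.2 ⟨ENNReal.sum_ne_top.2 fun i _ => ht i,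
    ENNReal.inv_ne_top.2 hθ'⟩, fun n => ?_⟩
  induction n using Nat.strong_induction_on with
  | _ n ih =>
    rcases lt_or_ge n (n₀ + R) with hn | hn
    · exact le_add_right (Finset.single_le_sum_of_canonicallyOrdered (Finset.mem_range.2 hn))
    obtain ⟨m, rfl⟩ := Nat.exists_eq_add_of_le' (le_of_add_le_right hn)
    calc t (m + R) ≤ θ * t m + 1 := hn₀ m (by lia)
      _ ≤ θ * B + (1 - θ) * B := by
        gcongr
        · exact ih m (by lia)
        · exact (ENNReal.mul_inv_cancel hθ' (by finiteness)).ge.trans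
            (mul_le_mul_right le_add_self _)
      _ = B := by rw [← add_mul, add_tsub_cancel_of_le hθ.le, one_mul]

lemma expGrowthSup_le_max_of_renewal {q : ENNReal} {R : ℕ} (hs : ∀ n, s n ≠ ⊤) (hR : 0 < R)
    (hq : q ≤ expE (R * c)) (h : ∀ n, s (n + R) ≤ q * s n + r (n + R)) :
    expGrowthSup s ≤ max ↑c (expGrowthSup r) := by
  refine EReal.le_of_forall_lt_iff_le.1 fun d hd => ?_
  obtain ⟨hcd, hrd⟩ := max_lt_iff.1 hd
  have hcancel : ∀ x, expE x * expE (-x) = 1 := fun x => by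
    rw [← expE_add, add_neg_cancel, expE, Real.exp_zero, ENNReal.ofReal_one]
  set t : ℕ → ENNReal := fun n => expE (-(n * d)) * s n
  have hθ : q * expE (-(R * d)) < 1 := by
    have hlt : expE (R * c) < expE (R * d) := by
      refine (ENNReal.ofReal_lt_ofReal_iff (Real.exp_pos _)).2 (Real.exp_lt_exp.2 ?_)
      have := EReal.coe_lt_coe_iff.1 hcd
      gcongr
    rw [← hcancel (R * d)]
    exact ENNReal.mul_lt_mul_left (expE_ne_zero _) (expE_ne_top _) (hq.trans_lt hlt)
  have hstep : ∀ᶠ n in atTop, t (n + R) ≤ q * expE (-(R * d)) * t n + 1 := by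
    filter_upwards [(tendsto_add_atTop_nat R).eventually (eventually_le_exp hrd)] with n hn
    rw [← expE_natCast_mul] at hn
    calc t (n + R) ≤ expE (-((n + R : ℕ) * d)) * (q * s n + expE ((n + R : ℕ) * d)) := by
          exact mul_le_mul_right ((h n).trans (by gcongr)) _
      _ = q * expE (-(R * d)) * t n + 1 := by
          rw [mul_add, mul_comm _ (expE ((n + R : ℕ) * d)), hcancel, Nat.cast_add, add_mul,
            neg_add, expE_add]
          ring
  obtain ⟨B, hB, htB⟩ := exists_forall_le_of_contracting
    (fun n => ENNReal.mul_ne_top (expE_ne_top _) (hs n)) hR hθ hstep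
  calc expGrowthSup s ≤ expGrowthSup fun n => expE (n * d) := by
        refine expGrowthSup_le_of_eventually_le hB (.of_forall fun n => ?_)
        calc s n = t n * expE (n * d) := by rw [mul_right_comm, mul_comm (expE _), hcancel, one_mul]
          _ ≤ B * expE (n * d) := by gcongr; exact htB n
    _ = d := expGrowthSup_expE d

end ExpGrowth

/-! ### Pressure -/

section Pressure

open ExpGrowth

variable {f φ : ℝ → ℝ} {X C D : Set ℝ} {E : Set (Set ℝ)} {n m k N : ℕ} {a b : ℝ}

lemma exists_subset_Icc_of_pairwiseDisjoint {ι α : Type*} [LinearOrder α] {s : Set ι}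
    (hs : s.Finite) (hcard : 2 < s.ncard) {A : ι → Set α} {x : ι → α}
    (hA : ∀ i ∈ s, (A i).OrdConnected) (hdisj : s.PairwiseDisjoint A)
    (hx : ∀ i ∈ s, x i ∈ A i) : ∃ i ∈ s, ∃ j ∈ s, ∃ k ∈ s, A i ⊆ Icc (x j) (x k) := by
  have hne : s.Nonempty := nonempty_of_ncard_ne_zero (by lia)
  obtain ⟨j, hj, hjmin⟩ := exists_min_image s x hs hne
  obtain ⟨k, hk, hkmax⟩ := exists_max_image s x hs hne
  obtain ⟨i, hi, hi'⟩ := exists_mem_notMem_of_ncard_lt_ncard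
    (((ncard_insert_le j {k}).trans_eq (by rw [ncard_singleton])).trans_lt hcard)
  simp only [mem_insert_iff, mem_singleton_iff, not_or] at hi'
  refine ⟨i, hi, j, hj, k, hk, fun y hy => ⟨?_, ?_⟩⟩
  · by_contra! hlt
    exact disjoint_left.1 (hdisj hi hj hi'.1)
      ((hA i hi).out hy (hx i hi) ⟨hlt.le, hjmin i hi⟩) (hx j hj)
  · by_contra! hlt
    exact disjoint_left.1 (hdisj hi hk hi'.2)
      ((hA i hi).out (hx i hi) hy ⟨hkmax i hi, hlt.le⟩) (hx k hk)

namespace IsPiecewiseMonotone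

lemma exists_cylinder_subset_Icc_subset (hf : IsPiecewiseMonotone f X) (hD : D ⊆ Ioo 0 1)
    (hDoc : D.OrdConnected) (hN : Ioo 0 1 ⊆ f^[N] '' D) (hm : 2 < (cylinders f m).ncard) :
    ∃ K, ∃ A ∈ cylinders f K, ∃ u v, A ⊆ Icc u v ∧ Icc u v ⊆ D := by
  choose! A hA hAC using fun C (hC : C ∈ cylinders f m) =>
    hf.exists_mem_cylinders_inter_preimage hD hN hC
  choose! x hx using fun C hC => (hA C hC).2
  have hdisj : (cylinders f m).PairwiseDisjoint A := fun B hB C hC hBC =>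
    disjoint_left.2 fun y hyB hyC =>
      hBC (eq_of_mem_cylinders hB hC (hAC B hB hyB) (hAC C hC hyC))
  obtain ⟨C, hC, B, hB, B', hB', hsub⟩ := exists_subset_Icc_of_pairwiseDisjoint
    (hf.finite_cylinders m) hm (fun C hC => ordConnected_of_mem_cylinders (hA C hC).1) hdisj
    fun C hC => (hx C hC).2
  exact ⟨_, A C, (hA C hC).1, x B, x B', hsub, hDoc.out (hx B hB).1 (hx B' hB').1⟩

lemma expGrowthSup_ncard_add_le (hf : IsPiecewiseMonotone f X) (ha : ∀ x ∈ X, a ≤ φ x) :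
    expGrowthSup (fun n => (cylinders f n).ncard) + a ≤ expGrowthSup (topSum f φ) := by
  rw [← expGrowthInf_expE a]
  exact le_expGrowthSup_mul.trans (expGrowthSup_monotone (hf.le_topSum ha))

lemma exists_two_lt_ncard_cylinders (hf : IsPiecewiseMonotone f X) (hb : ∀ x ∈ X, φ x ≤ b)
    (hbP : b < expGrowthSup (topSum f φ)) : ∃ m, 2 < (cylinders f m).ncard := by
  by_contra! hle
  rw [← expGrowthSup_expE b] at hbP
  refine hbP.not_ge (expGrowthSup_le_of_eventually_le (b := 2) (by finiteness)
    (.of_forall fun n => (hf.topSum_le hb n).trans ?_))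
  gcongr
  exact_mod_cast hle n

lemma exists_expGrowthSup_le_cylindersReturning (hf : IsPiecewiseMonotone f X)
    (hb : ∀ x ∈ X, φ x ≤ b) (hD : IsOpen D) (hDoc : D.OrdConnected)
    (hbD : b < expGrowthSup fun n => weightSum f φ n (cylindersMeeting f n D)) :
    ∃ R, expGrowthSup (fun n => weightSum f φ n (cylindersMeeting f n D)) ≤
      expGrowthSup fun n => weightSum f φ n (cylindersReturning f n R D) := by
  obtain ⟨c, hbc, hc⟩ := EReal.lt_iff_exists_real_btwn.1 hbD
  have hδ : 0 < c - b := sub_pos.2 (EReal.coe_lt_coe_iff.1 hbc)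
  obtain ⟨R, hR⟩ := exists_nat_gt (Real.log 2 / (c - b))
  have hRpos : 0 < R := Nat.cast_pos.1 ((div_pos (Real.log_pos one_lt_two) hδ).trans hR)
  have hq : 2 * expE (R * b) ≤ expE (R * c) := by
    have htwo : expE (Real.log 2) = 2 := by
      rw [expE, Real.exp_log two_pos, ENNReal.ofReal_ofNat]
    rw [← htwo, ← expE_add]
    rw [div_lt_iff₀ hδ] at hR
    exact expE_mono (by linarith)
  have hfin : ∀ n, weightSum f φ n (cylindersMeeting f n D) ≠ ⊤ := fun n =>
    ne_top_of_le_ne_top (hf.topSum_ne_top hb n) (weightSum_le_topSum (sep_subset _ _))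
  exact ⟨R, (le_max_iff.1 (expGrowthSup_le_max_of_renewal hfin hRpos hq fun n =>
    hf.weightSum_cylindersMeeting_add_le hb hD hDoc n R)).resolve_left hc.not_ge⟩

end IsPiecewiseMonotone

variable (hf : IsMixingPiecewiseMonotone f X) (hφ : MapsTo φ X (Icc a b))
  (hβ : (fun n => beta f φ n) =o[atTop] fun n : ℕ => (n : ℝ)) (hE : IsTransitivePart f E)
include hf hφ hβ hE

lemma IsTransitivePart.expGrowthInf_topSum_le_cylindersMeeting (hD : D ∈ E) :
    expGrowthInf (topSum f φ) ≤
      expGrowthInf fun n => weightSum f φ n (cylindersMeeting f n D) := by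
  obtain ⟨N, hN⟩ := hE.exists_Ioo_subset_image hf hD
  exact expGrowthInf_le_of_shift hβ fun m => hf.le_weightSum_cylindersMeeting hφ
    (hf.subset_Ioo_of_mem_domains (hE.subset hD)) hN m

lemma IsTransitivePart.expGrowthInf_topSum_le_hatTopSum (hD : D ∈ E) (hC : C ∈ cylinders f k)
    (hne : (D ∩ C).Nonempty) :
    expGrowthInf (topSum f φ) ≤ expGrowthInf (hatTopSum f φ ((D ∩ C) ×ˢ {D})) :=
  (hE.expGrowthInf_topSum_le_cylindersMeeting hf hφ hβ
    (hE.image_mem hf.toIsPiecewiseMonotone hD hC hne)).trans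
  (expGrowthInf_le_of_shift hβ fun m => hf.le_hatTopSum hφ (hE.subset hD) hC m)

lemma IsTransitivePart.expGrowthInf_topSum_le_hatZ (hD : D ∈ E) (hC : C ∈ cylinders f k)
    (hne : (D ∩ C).Nonempty) (hbP : b < expGrowthInf (topSum f φ)) :
    expGrowthInf (topSum f φ) ≤ expGrowthSup (hatZ f φ ((D ∩ C) ×ˢ {D})) := by
  have hb : ∀ x ∈ X, φ x ≤ b := fun x hx => (hφ hx).2
  have hpm := hf.toIsPiecewiseMonotone
  have hDsub := hf.subset_Ioo_of_mem_domains (hE.subset hD)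
  obtain ⟨m, hm⟩ := hf.exists_two_lt_ncard_cylinders hb
    (hbP.trans_le expGrowthInf_le_expGrowthSup)
  obtain ⟨N, hN⟩ := hE.exists_Ioo_subset_image hf (hE.image_mem hpm hD hC hne)
  rw [← image_comp, ← Function.iterate_add] at hN
  obtain ⟨K, A, hA, u, v, hAuv, huv⟩ := hf.exists_cylinder_subset_Icc_subset
    (inter_subset_left.trans hDsub) ((ordConnected_of_mem_domains (hE.subset hD)).inter
    (ordConnected_of_mem_cylinders hC)) hN hm
  have hDA : D ∩ A = A := inter_eq_right.2 fun x hx => (huv (hAuv hx)).1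
  have hAE : f^[K] '' A ∈ E := by
    rw [← hDA]
    exact hE.image_mem hpm hD hA (hDA.symm ▸ hA.1)
  have hgrowth := (hE.expGrowthInf_topSum_le_cylindersMeeting hf hφ hβ hAE).trans
    expGrowthInf_le_expGrowthSup
  obtain ⟨R, hR⟩ := hf.exists_expGrowthSup_le_cylindersReturning hb
    (isOpen_of_mem_domains (hE.subset hAE)) (ordConnected_of_mem_domains (hE.subset hAE))
    (hbP.trans_le hgrowth)
  have hpath : ∀ᶠ l in atTop, ∀ G ∈ (f^[R] '' ·) '' cylinders f R ∩ E, HasPath f l G D :=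
    (((hf.finite_cylinders R).image _).inter_of_left E).eventually_all.2 fun G hG =>
      hE.primitive G hG.2 D hD
  obtain ⟨l, hl⟩ := hpath.exists
  refine hgrowth.trans (hR.trans (expGrowthSup_le_of_shift hβ (k := K + l)
    (d := (K + l : ℕ) * a) fun n => ?_))
  rw [show K + l + n = K + n + l by ring]
  refine hf.le_hatZ hφ hDsub inter_subset_left hA hAuv huv (sep_subset _ _) ?_
  rintro B ⟨⟨hB, hne⟩, T, hT, himg⟩
  exact hl _ ⟨⟨T, hT, himg.symm⟩, hE.image_mem hpm hAE hB hne⟩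

end Pressure

/-! ### Topological entropy -/

section Entropy

open ExpGrowth

variable {f : ℝ → ℝ} {X C : Set ℝ} {n M i : ℕ} {x y : ℝ}

open Classical in
/-- Up to the orientation of the iterates on `C`, the sum of the labels of the intervals of length
`1 / M` visited by the first `n` points of the orbit of `x`. As `x` increases in a cylinder `C`, no
summand decreases, so the sum alone determines all the labels. -/
def orbitCode (f : ℝ → ℝ) (M n : ℕ) (C : Set ℝ) (x : ℝ) : ℤ :=
  ∑ i ∈ Finset.range n, if StrictMonoOn f^[i] C then ⌊M * f^[i] x⌋ else -⌊M * f^[i] x⌋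

lemma orbitCode_mem_Icc (hf : IsPiecewiseMonotone f X) (hx : x ∈ X) :
    orbitCode f M n C x ∈ Icc (-(n * M : ℤ)) (n * M) := by
  have hfloor : ∀ i, 0 ≤ ⌊M * f^[i] x⌋ ∧ ⌊M * f^[i] x⌋ ≤ M := by
    intro i
    obtain ⟨h0, h1⟩ := hf.subset_Icc (hf.mapsTo.iterate i hx)
    have hM : (0 : ℝ) ≤ M := M.cast_nonneg
    refine ⟨Int.floor_nonneg.2 (mul_nonneg hM h0), Int.floor_le_iff.2 ?_⟩
    push_cast
    nlinarith
  rw [mem_Icc, ← abs_le]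
  refine (Finset.abs_sum_le_sum_abs _ _).trans ?_
  refine (Finset.sum_le_card_nsmul _ _ (M : ℤ) fun i _ => ?_).trans (by simp)
  split_ifs
  · exact (abs_of_nonneg (hfloor i).1).trans_le (hfloor i).2
  · exact (abs_neg _).trans_le ((abs_of_nonneg (hfloor i).1).trans_le (hfloor i).2)

lemma abs_sub_le_of_orbitCode_eq (hM : 0 < M) (hC : C ∈ cylinders f n) (hx : x ∈ C)
    (hy : y ∈ C) (h : orbitCode f M n C x = orbitCode f M n C y) (hi : i < n) :
    |f^[i] x - f^[i] y| ≤ 1 / M := by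
  wlog hxy : x ≤ y generalizing x y
  · rw [abs_sub_comm]
    exact this hy hx h.symm (le_of_not_ge hxy)
  have hM' : (0 : ℝ) < M := Nat.cast_pos.2 hM
  have hterm := (Finset.sum_eq_sum_iff_of_le fun i hi => by
    split_ifs with hs
    · exact Int.floor_le_floor (mul_le_mul_of_nonneg_left (hs.monotoneOn hx hy hxy) hM'.le)
    · have hs' :=
        (isMonotoneInterval_iterate hC (Finset.mem_range.1 hi).le).strict.resolve_left hs
      exact neg_le_neg (Int.floor_le_floor
        (mul_le_mul_of_nonneg_left (hs'.antitoneOn hx hy hxy) hM'.le))).1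
    h i (Finset.mem_range.2 hi)
  have hfloor : ⌊M * f^[i] x⌋ = ⌊M * f^[i] y⌋ := by
    split_ifs at hterm
    exacts [hterm, neg_injective hterm]
  have habs := Int.abs_sub_lt_one_of_floor_eq_floor hfloor
  rw [← mul_sub, abs_mul, abs_of_pos hM'] at habs
  rw [le_div_iff₀ hM', mul_comm]
  exact habs.le

lemma IsPiecewiseMonotone.exists_finite_shadowing (hf : IsPiecewiseMonotone f X) (hM : 0 < M)
    (n : ℕ) :
    ∃ s ⊆ Ioo (0 : ℝ) 1, s.Finite ∧ s.ncard ≤ (cylinders f n).ncard * (n * (2 * M) + 1) ∧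
      ∀ x ∈ Ioo (0 : ℝ) 1, (∀ i < n, f^[i] x ∈ ⋃₀ branches f) →
        ∃ y ∈ s, ∀ i < n, |f^[i] x - f^[i] y| ≤ 1 / M := by
  set G : Set ℝ := {x ∈ Ioo 0 1 | ∀ i < n, f^[i] x ∈ ⋃₀ branches f}
  choose! cyl hcyl hmem using fun (x : ℝ) (hx : x ∈ G) => exists_mem_cylinders hx.1 hx.2
  let code : ℝ → Set ℝ × ℤ := fun x => (cyl x, orbitCode f M n (cyl x) x)
  have hcode : code '' G ⊆ cylinders f n ×ˢ Icc (-(n * M : ℤ)) (n * M) := by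
    rintro _ ⟨x, hx, rfl⟩
    exact ⟨hcyl x hx, orbitCode_mem_Icc hf (hf.Ioo_subset hx.1)⟩
  have hfin : (cylinders f n ×ˢ Icc (-(n * M : ℤ)) (n * M)).Finite :=
    (hf.finite_cylinders n).prod (finite_Icc _ _)
  obtain ⟨s, hs, hbij⟩ := exists_subset_bijOn G code
  refine ⟨s, hs.trans (sep_subset _ _), hbij.finite_iff_finite.2 (hfin.subset hcode), ?_, ?_⟩
  · rw [← hbij.injOn.ncard_image, hbij.image_eq]
    refine (ncard_le_ncard hcode hfin).trans ?_
    rw [ncard_prod, ← Finset.coe_Icc, ncard_coe_finset, Int.card_Icc]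
    gcongr
    lia
  · intro x hx hxb
    obtain ⟨y, hy, hxy⟩ := hbij.surjOn (mem_image_of_mem code ⟨hx, hxb⟩)
    obtain ⟨hcyl_eq, hcode_eq⟩ := Prod.ext_iff.1 hxy
    simp only [code] at hcyl_eq hcode_eq
    rw [hcyl_eq] at hcode_eq
    exact ⟨y, hy, fun i hi => abs_sub_le_of_orbitCode_eq hM (hcyl x ⟨hx, hxb⟩) (hmem x ⟨hx, hxb⟩)
      (hcyl_eq ▸ hmem y (hs hy)) hcode_eq.symm hi⟩

/-- `T : F → F` is continuous and `π : X → F` is a `1`-Lipschitz semiconjugacy from `f` to `T`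
that maps the complement of each finite subset of `(0,1)` to a dense subset of `F`. It is the
inclusion for interval maps and the projection to `ℝ / ℤ` for circle maps. -/
structure IsDenseFactor {Y : Type*} [PseudoMetricSpace Y] (f : ℝ → ℝ) (X : Set ℝ) (T : Y → Y)
    (F : Set Y) (π : ℝ → Y) : Prop where
  isClosed : IsClosed F
  continuousOn : ContinuousOn T F
  mapsTo_self : MapsTo T F F
  mapsTo : MapsTo π X F
  semiconj : ∀ x ∈ X, T (π x) = π (f x)
  dist_le : ∀ x y, dist (π x) (π y) ≤ |x - y|
  dense : ∀ S : Set ℝ, S.Finite → F ⊆ closure (π '' (Ioo 0 1 \ S))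

variable {Y : Type*} [PseudoMetricSpace Y] {T : Y → Y} {F : Set Y} {π : ℝ → Y}

lemma IsDenseFactor.iterate_semiconj (h : IsDenseFactor f X T F π) (hX : MapsTo f X X)
    (hx : x ∈ X) (i : ℕ) : T^[i] (π x) = π (f^[i] x) := by
  induction i with
  | zero => rfl
  | succ i ih =>
    rw [Function.iterate_succ_apply', Function.iterate_succ_apply', ih,
      h.semiconj _ (hX.iterate i hx)]

lemma IsDenseFactor.coverMincard_le (h : IsDenseFactor f X T F π) (hf : IsPiecewiseMonotone f X)
    {U : SetRel Y Y} (hM : 0 < M) (hU : ∀ x y : Y, dist x y ≤ 1 / M → (x, y) ∈ U) (n : ℕ) :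
    Dynamics.coverMincard T F U n ≤ ((cylinders f n).ncard * (n * (2 * M) + 1) : ℕ) := by
  classical
  obtain ⟨s, hs, hfin, hcard, hshadow⟩ := hf.exists_finite_shadowing hM n
  set Z : Set Y := ⋃ y ∈ s, ⋂ i < n, F ∩ T^[i] ⁻¹' Metric.closedBall (T^[i] (π y)) (1 / M)
  have hZ : IsClosed Z := hfin.isClosed_biUnion fun y _ => isClosed_iInter fun i =>
    isClosed_iInter fun _ => (h.continuousOn.iterate h.mapsTo_self i).preimage_isClosed_of_isClosed
      h.isClosed Metric.isClosed_closedBall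
  have hsub : π '' (Ioo 0 1 \ {x ∈ X | ∃ i < n, f^[i] x ∉ ⋃₀ branches f}) ⊆ Z := by
    rintro _ ⟨x, ⟨hx, hxb⟩, rfl⟩
    have hxX := hf.Ioo_subset hx
    obtain ⟨y, hy, hxy⟩ := hshadow x hx fun i hi => by_contra fun h => hxb ⟨hxX, i, hi, h⟩
    refine mem_biUnion hy (mem_iInter₂.2 fun i hi => ⟨h.mapsTo hxX, ?_⟩)
    rw [mem_preimage, Metric.mem_closedBall, h.iterate_semiconj hf.mapsTo hxX,
      h.iterate_semiconj hf.mapsTo (hf.Ioo_subset (hs hy))]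
    exact (h.dist_le _ _).trans (hxy i hi)
  have hcover : Dynamics.IsDynCoverOf T F U n (hfin.toFinset.image π : Finset Y) := by
    intro z hz
    obtain ⟨y, hy, hzy⟩ := mem_iUnion₂.1
      (closure_minimal hsub hZ (h.dense _ (hf.finite_exceptional_iterate n) hz))
    refine ⟨π y, by simpa using ⟨y, hy, rfl⟩, Dynamics.mem_dynEntourage.2 fun i hi => hU _ _ ?_⟩
    exact (mem_iInter₂.1 hzy i hi).2
  refine hcover.coverMincard_le_card.trans (Nat.cast_le.2 (Finset.card_image_le.trans ?_))
  rwa [← ncard_eq_toFinset_card s hfin]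

lemma expGrowthSup_natCast_mul_add_one (a : ℕ) :
    expGrowthSup (fun n => ((n * a + 1 : ℕ) : ENNReal)) = 0 := by
  refine le_antisymm (EReal.le_of_forall_lt_iff_le.1 fun δ hδ => ?_) ?_
  · have hlin : (fun n : ℕ => ((n * a + 1 : ℕ) : ℝ)) =o[atTop] fun n : ℕ => Real.exp δ ^ n := by
      have hexp : 1 < Real.exp δ := Real.one_lt_exp_iff.2 (EReal.coe_pos.1 hδ)
      push_cast
      simp only [mul_comm _ (a : ℝ)]
      exact ((isLittleO_coe_const_pow_of_one_lt hexp).const_mul_left _).add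
        (by simpa using isLittleO_pow_pow_of_lt_left zero_le_one hexp)
    rw [← expGrowthSup_expE δ]
    refine expGrowthSup_eventually_monotone ?_
    filter_upwards [hlin.bound one_pos] with n hn
    rw [one_mul, Real.norm_of_nonneg (by positivity), Real.norm_of_nonneg (by positivity),
      ← Real.exp_nat_mul] at hn
    rw [expE, ← ENNReal.ofReal_natCast]
    exact ENNReal.ofReal_le_ofReal hn
  · rw [← EReal.coe_zero, ← expGrowthSup_expE 0]
    refine expGrowthSup_monotone fun n => ?_
    simp [expE]

theorem IsDenseFactor.coverEntropy_le (h : IsDenseFactor f X T F π) (hf : IsPiecewiseMonotone f X) :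
    Dynamics.coverEntropy T F ≤ expGrowthSup (fun n => ((cylinders f n).ncard : ENNReal)) := by
  refine iSup₂_le fun U hU => ?_
  obtain ⟨ε, hε, hεU⟩ := Metric.mem_uniformity_dist.1 hU
  obtain ⟨m, hm⟩ := exists_nat_one_div_lt hε
  have hU' : ∀ x y : Y, dist x y ≤ 1 / (m + 1 : ℕ) → (x, y) ∈ U := fun x y hxy =>
    hεU (hxy.trans_lt (by exact_mod_cast hm))
  have hzero := expGrowthSup_natCast_mul_add_one (2 * (m + 1))
  calc expGrowthSup (fun n => (Dynamics.coverMincard T F U n : ENNReal))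
      ≤ expGrowthSup ((fun n => ((cylinders f n).ncard : ENNReal)) *
          fun n => ((n * (2 * (m + 1)) + 1 : ℕ) : ENNReal)) := by
        refine expGrowthSup_monotone fun n => ?_
        rw [Pi.mul_apply, ← Nat.cast_mul]
        exact ENat.toENNReal_le.2 (h.coverMincard_le hf m.succ_pos hU' n)
    _ ≤ _ := expGrowthSup_mul_le (.inr (hzero ▸ EReal.zero_ne_top))
        (.inr (hzero ▸ EReal.zero_ne_bot))
    _ = _ := by rw [hzero, add_zero]

end Entropy

/-! ### Intervals that cover themselves -/

section Exactness

lemma subset_of_dense_orbit {Y : Type*} [TopologicalSpace Y] [T1Space Y] {h : Y → Y}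
    {F V O : Set Y} {x : Y} (hF : Preperfect F) (hFm : MapsTo h F F) (hx : x ∈ F)
    (hdense : F ⊆ closure (range fun k : ℕ => h^[k] x)) (hV : IsClosed V) (hVm : MapsTo h V V)
    (hO : IsOpen O) (hne : (O ∩ F).Nonempty) (hOV : O ∩ F ⊆ V) : F ⊆ V := by
  obtain ⟨y, hyO, hyF⟩ := hne
  obtain ⟨_, hjO, j, rfl⟩ := mem_closure_iff.1 (hdense hyF) O hO hyO
  have hjV : h^[j] x ∈ V := hOV ⟨hjO, hFm.iterate j hx⟩
  set S : Set Y := (fun i => h^[i] x) '' Iio j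
  have hS : S.Finite := (finite_Iio j).image _
  have horbit : range (fun k : ℕ => h^[k] x) ⊆ S ∪ V := by
    rintro _ ⟨k, rfl⟩
    rcases lt_or_ge k j with hk | hk
    · exact .inl ⟨k, hk, rfl⟩
    · obtain ⟨i, rfl⟩ := Nat.exists_eq_add_of_le' hk
      exact .inr (by simpa only [Function.iterate_add_apply] using hVm.iterate i hjV)
  have hFSV : F ⊆ S ∪ V := hdense.trans (closure_minimal horbit (hS.isClosed.union hV))
  intro z hzF
  by_contra hzV
  exact Set.Infinite.of_accPt (hF.open_inter hV.isOpen_compl z ⟨hzV, hzF⟩)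
    (hS.subset fun w hw => (hFSV hw.2).resolve_right hw.1)

lemma eventually_nhdsGT_mapsTo_Ici {g : ℝ → ℝ} {p q : ℝ} (hpq : p < q)
    (hc : ContinuousOn g (Icc p q)) (hm : MapsTo g (Icc p q) (Ici p)) (hp : g p = p)
    (hd : 1 < |derivWithin g (Icc p q) p|) (hpre : ∀ x ∈ Icc p q, g x = p → x = p) :
    ∀ᶠ u in 𝓝[>] p, MapsTo g (Icc u q) (Ici u) := by
  have hdiff : DifferentiableWithinAt ℝ g (Icc p q) p :=
    differentiableWithinAt_of_derivWithin_ne_zero fun h0 => by norm_num [h0] at hd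
  have hslope := hasDerivWithinAt_iff_tendsto_slope.1 hdiff.hasDerivWithinAt
  rw [Icc_sdiff_left, nhdsWithin_Ioc_eq_nhdsGT hpq] at hslope
  have hnear : ∀ᶠ x in 𝓝[>] p, x ≤ g x := by
    filter_upwards [hslope.abs.eventually_const_lt hd, Ioc_mem_nhdsGT hpq] with x hx hxI
    have hpx : 0 < x - p := sub_pos.2 hxI.1
    have hgx : 0 ≤ g x - p := sub_nonneg.2 (hm (Ioc_subset_Icc_self hxI))
    rw [slope_def_field, hp, abs_of_nonneg (div_nonneg hgx hpx.le), one_lt_div hpx] at hx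
    linarith
  obtain ⟨e, ⟨hpe, heq⟩, hnear⟩ := (mem_nhdsGT_iff_exists_mem_Ioc_Ioo_subset hpq).1 hnear
  have hsub : Icc e q ⊆ Icc p q := Icc_subset_Icc_left hpe.le
  obtain ⟨y, hy, hmin⟩ := isCompact_Icc.exists_isMinOn (nonempty_Icc.2 heq) (hc.mono hsub)
  have hgy : p < g y := (hm (hsub hy)).lt_of_ne' fun h => (hpe.trans_le hy.1).ne'
    (hpre y (hsub hy) h)
  filter_upwards [Ioc_mem_nhdsGT hgy, self_mem_nhdsWithin] with u hu hpu x hx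
  rcases lt_or_ge x e with hxe | hxe
  · exact hx.1.trans (hnear ⟨hpu.trans_le hx.1, hxe⟩)
  · exact hu.2.trans (hmin ⟨hxe, hx.2⟩)

lemma eventually_nhdsLT_mapsTo_Iic {g : ℝ → ℝ} {p q : ℝ} (hpq : p < q)
    (hc : ContinuousOn g (Icc p q)) (hm : MapsTo g (Icc p q) (Iic q)) (hq : g q = q)
    (hd : 1 < |derivWithin g (Icc p q) q|) (hpre : ∀ x ∈ Icc p q, g x = q → x = q) :
    ∀ᶠ v in 𝓝[<] q, MapsTo g (Icc p v) (Iic v) := by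
  have hneg : ∀ a b : ℝ, MapsTo Neg.neg (Icc (-b) (-a)) (Icc a b) := fun _ _ _ hx =>
    ⟨le_neg_of_le_neg hx.2, neg_le_of_neg_le hx.1⟩
  have hderiv : |derivWithin (fun x => -g (-x)) (Icc (-q) (-p)) (-q)| =
      |derivWithin g (Icc p q) q| := by
    rw [derivWithin.fun_neg, derivWithin_comp_neg, neg_neg, neg_neg, neg_Icc, neg_neg, neg_neg]
  have htrap := eventually_nhdsGT_mapsTo_Ici (g := fun x => -g (-x)) (neg_lt_neg hpq)
    (hc.comp continuousOn_neg (hneg p q)).neg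
    (fun x hx => mem_Ici.2 (neg_le_neg (mem_Iic.1 (hm (hneg p q hx))))) (by simp only [neg_neg, hq])
    (hderiv ▸ hd)
    (fun x hx hxq => neg_eq_iff_eq_neg.1 (hpre (-x) (hneg p q hx) (neg_injective hxq)))
  filter_upwards [tendsto_neg_nhdsLT.eventually htrap] with v hv x hx
  simpa using hv (hneg _ _ (by simpa using hx))

lemma iterate_two_eq_of_diff_subset_pair {α : Type*} {h : α → α} {S K : Set α} {a b e : α}
    (hm : MapsTo h S S) (hsurj : S ⊆ h '' S) (hK : MapsTo h K K) (hpair : S \ K ⊆ {a, b})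
    (he : e ∈ S \ K) : h^[2] e = e ∧ ∀ x ∈ S, h^[2] x = e → x = e := by
  have hback : ∀ x ∈ S, h x ∉ K → x ∈ S \ K := fun x hx hxK => ⟨hx, fun h => hxK (hK h)⟩
  have hfix : ∀ e ∈ S \ K, h^[2] e = e := by
    rintro e ⟨heS, heK⟩
    obtain ⟨x, hxS, rfl⟩ := hsurj heS
    have hx := hback x hxS heK
    obtain ⟨y, hyS, rfl⟩ := hsurj hxS
    have hy := hpair (hback y hyS hx.2)
    have hhy := hpair hx
    have hhhy := hpair ⟨heS, heK⟩
    simp only [Function.iterate_succ_apply, Function.iterate_zero_apply]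
    grind
  refine ⟨hfix e he, ?_⟩
  rintro x hx rfl
  exact (hfix x (hback x hx (hback (h x) (hm hx) he.2).2)).symm

section

variable {α : Type*} {h : α → α} {D : Set α}

lemma monotone_image_iterate (hD : D ⊆ h '' D) : Monotone fun i => h^[i] '' D :=
  monotone_nat_of_le_succ fun i => by
    rw [Function.iterate_succ, image_comp]
    exact image_mono hD

lemma image_iUnion_image_iterate (hD : D ⊆ h '' D) :
    h '' ⋃ i, h^[i] '' D = ⋃ i, h^[i] '' D := by
  have hsucc : ∀ i, h '' (h^[i] '' D) = h^[i + 1] '' D := fun i => by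
    rw [Function.iterate_succ', image_comp]
  simp only [image_iUnion, hsucc]
  exact (monotone_image_iterate hD).iSup_nat_add 1

end

variable {h : ℝ → ℝ} {p q : ℝ} {K D : Set ℝ}

lemma csInf_lt_csSup_and_closure_eq_Icc (hKo : K.OrdConnected) (hKn : K.Nontrivial)
    (hb : BddBelow K) (ha : BddAbove K) :
    sInf K < sSup K ∧ closure K = Icc (sInf K) (sSup K) := by
  obtain ⟨x, hx, y, hy, hxy⟩ := hKn.exists_lt
  have hlt : sInf K < sSup K := (csInf_le hb hx).trans_lt (hxy.trans_le (le_csSup ha hy))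
  refine ⟨hlt, (closure_minimal (subset_Icc_csInf_csSup hb ha) isClosed_Icc).antisymm ?_⟩
  rw [← closure_Ioo hlt.ne]
  exact closure_mono
    (IsConnected.Ioo_csInf_csSup_subset ⟨hKn.nonempty, hKo.isPreconnected⟩ hb ha)

lemma Ioo_subset_of_mapsTo (hc : ContinuousOn h (Icc p q))
    (hinv : ∀ u v, p ≤ u → u < v → v ≤ q → MapsTo h (Icc u v) (Icc u v) → u = p ∧ v = q)
    (hK : K ⊆ Icc p q) (hKm : MapsTo h K K) (hKo : K.OrdConnected) (hKn : K.Nontrivial) :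
    Ioo p q ⊆ K := by
  obtain ⟨hlt, hcl⟩ := csInf_lt_csSup_and_closure_eq_Icc hKo hKn (bddBelow_Icc.mono hK)
    (bddAbove_Icc.mono hK)
  have hclm : MapsTo h (closure K) (closure K) :=
    hKm.closure_of_continuousOn (hc.mono (closure_minimal hK isClosed_Icc))
  obtain ⟨hp, hq⟩ := hinv _ _ (le_csInf hKn.nonempty fun x hx => (hK hx).1) hlt
    (csSup_le hKn.nonempty fun x hx => (hK hx).2) (hcl ▸ hclm)
  rw [← hp, ← hq]
  exact IsConnected.Ioo_csInf_csSup_subset ⟨hKn.nonempty, hKo.isPreconnected⟩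
    (bddBelow_Icc.mono hK) (bddAbove_Icc.mono hK)

/- A missing endpoint `e` would be a fixed point of `h^[2]` without other preimages. Since it is
repelling, shortening `[p, q]` slightly at the missing endpoints gives an `h^[2]`-invariant
interval. -/
lemma Icc_subset_of_image_eq (hpq : p < q) (hc : ContinuousOn h (Icc p q))
    (hm : MapsTo h (Icc p q) (Icc p q))
    (hinv : ∀ u v, p ≤ u → u < v → v ≤ q → MapsTo h^[2] (Icc u v) (Icc u v) → u = p ∧ v = q)
    (hrep : ∀ e ∈ Icc p q, h^[2] e = e → 1 < |derivWithin h^[2] (Icc p q) e|)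
    (hK : h '' K = K) (hIoo : Ioo p q ⊆ K) (hKI : K ⊆ Icc p q) : Icc p q ⊆ K := by
  have hpair : Icc p q \ K ⊆ {p, q} := by
    rintro x ⟨hx, hxK⟩
    rw [← Icc_sdiff_Ioo_same hpq.le]
    exact ⟨hx, fun h => hxK (hIoo h)⟩
  have hsurj : Icc p q ⊆ h '' Icc p q := by
    have hclosed := (isCompact_Icc.image_of_continuousOn hc).isClosed
    have hsub := closure_minimal ((hIoo.trans hK.ge).trans (image_mono hKI)) hclosed
    rwa [closure_Ioo hpq.ne] at hsub
  have hfix : ∀ e ∈ Icc p q \ K, h^[2] e = e ∧ ∀ x ∈ Icc p q, h^[2] x = e → x = e := fun e he =>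
    iterate_two_eq_of_diff_subset_pair hm hsurj (mapsTo_iff_image_subset.2 hK.le) hpair he
  have hpI := left_mem_Icc.2 hpq.le
  have hqI := right_mem_Icc.2 hpq.le
  have hm2 := hm.iterate 2
  obtain ⟨c, hpc, hcq⟩ := exists_between hpq
  obtain ⟨u, ⟨hpu, huc⟩, hu, hpK⟩ : ∃ u ∈ Ico p c, MapsTo h^[2] (Icc u q) (Ici u) ∧
      (u = p → p ∈ K) := by
    by_cases hpK : p ∈ K
    · exact ⟨p, ⟨le_rfl, hpc⟩, fun x hx => (hm2 hx).1, fun _ => hpK⟩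
    · obtain ⟨hfp, hpre⟩ := hfix p ⟨hpI, hpK⟩
      obtain ⟨u, hu, hu'⟩ := ((eventually_nhdsGT_mapsTo_Ici hpq (hc.iterate hm 2)
        (fun x hx => (hm2 hx).1) hfp (hrep p hpI hfp) hpre).and (Ioo_mem_nhdsGT hpc)).exists
      exact ⟨u, ⟨hu'.1.le, hu'.2⟩, hu, fun h => absurd h hu'.1.ne'⟩
  obtain ⟨v, ⟨hcv, hvq⟩, hv, hqK⟩ : ∃ v ∈ Ioc c q, MapsTo h^[2] (Icc p v) (Iic v) ∧
      (v = q → q ∈ K) := by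
    by_cases hqK : q ∈ K
    · exact ⟨q, ⟨hcq, le_rfl⟩, fun x hx => (hm2 hx).2, fun _ => hqK⟩
    · obtain ⟨hfq, hpre⟩ := hfix q ⟨hqI, hqK⟩
      obtain ⟨v, hv, hv'⟩ := ((eventually_nhdsLT_mapsTo_Iic hpq (hc.iterate hm 2)
        (fun x hx => (hm2 hx).2) hfq (hrep q hqI hfq) hpre).and (Ioo_mem_nhdsLT hcq)).exists
      exact ⟨v, ⟨hv'.1, hv'.2.le⟩, hv, fun h => absurd h hv'.2.ne⟩
  obtain ⟨hup, hvq⟩ := hinv u v hpu (huc.trans hcv) hvq fun x hx =>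
    ⟨hu ⟨hx.1, hx.2.trans hvq⟩, hv ⟨hpu.trans hx.1, hx.2⟩⟩
  intro x hx
  by_contra hxK
  rcases hpair ⟨hx, hxK⟩ with rfl | rfl
  exacts [hxK (hpK hup), hxK (hqK hvq)]

lemma exists_Icc_subset_image_iterate (hpq : p < q) (hc : ContinuousOn h (Icc p q))
    (hm : MapsTo h (Icc p q) (Icc p q))
    (hinv : ∀ u v, p ≤ u → u < v → v ≤ q → MapsTo h^[2] (Icc u v) (Icc u v) → u = p ∧ v = q)
    (hrep : ∀ e ∈ Icc p q, h^[2] e = e → 1 < |derivWithin h^[2] (Icc p q) e|)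
    (hD : D ⊆ Icc p q) (hDo : D.OrdConnected) (hDn : D.Nontrivial) (hDh : D ⊆ h '' D) :
    ∃ i, Icc p q ⊆ h^[i] '' D := by
  have hmono := monotone_image_iterate hDh
  have hconn : ∀ i, IsPreconnected (h^[i] '' D) := fun i =>
    hDo.isPreconnected.image _ ((hc.iterate hm i).mono hD)
  set K : Set ℝ := ⋃ i, h^[i] '' D
  have hDi : ∀ i, D ⊆ h^[i] '' D := fun i => by simpa using hmono (Nat.zero_le i)
  have hK : K ⊆ Icc p q := iUnion_subset fun i => ((hm.iterate i).mono_left hD).image_subset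
  have hKh : h '' K = K := image_iUnion_image_iterate hDh
  have hKm : MapsTo h K K := mapsTo_iff_image_subset.2 hKh.le
  have hKo : K.OrdConnected :=
    (isPreconnected_iUnion (hDn.nonempty.mono (subset_iInter hDi)) hconn).ordConnected
  have hKn : K.Nontrivial := hDn.mono (by simpa using subset_iUnion (fun i => h^[i] '' D) 0)
  have hIcc : Icc p q ⊆ K := Icc_subset_of_image_eq hpq hc hm hinv hrep hKh
    (Ioo_subset_of_mapsTo (hc.iterate hm 2) hinv hK (hKm.iterate 2) hKo hKn) hK
  obtain ⟨i, hi⟩ := mem_iUnion.1 (hIcc (left_mem_Icc.2 hpq.le))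
  obtain ⟨j, hj⟩ := mem_iUnion.1 (hIcc (right_mem_Icc.2 hpq.le))
  exact ⟨max i j, (hconn _).ordConnected.out (hmono (le_max_left i j) hi)
    (hmono (le_max_right i j) hj)⟩

end Exactness

/-! ### Smooth interval maps -/

section SmoothMaps

variable {f F : ℝ → ℝ} {Z S : Set ℝ} {x c d : ℝ}

lemma exists_isMonotoneInterval_of_hasStrictDerivAt (hx : x ∈ Ioo 0 1)
    (hF : HasStrictDerivAt F d x) (hd : d ≠ 0) (heq : ∀ᶠ y in 𝓝 x, f y = F y + c) :
    ∃ J, IsMonotoneInterval f J ∧ x ∈ J := by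
  set e := (hF.hasStrictFDerivAt_equiv hd).toOpenPartialHomeomorph F
  have hsource : e.source ∈ 𝓝 x := e.open_source.mem_nhds
    (hF.hasStrictFDerivAt_equiv hd).mem_toOpenPartialHomeomorph_source
  obtain ⟨ε, hε, hball⟩ := Metric.mem_nhds_iff.1
    (inter_mem (inter_mem (Ioo_mem_nhds hx.1 hx.2) hsource) heq)
  have hfF : EqOn f (fun y => F y + c) (Metric.ball x ε) := fun y hy => (hball hy).2
  have hsub : Metric.ball x ε ⊆ e.source := fun y hy => (hball hy).1.2
  exact ⟨Metric.ball x ε, .of_injOn Metric.isOpen_ball ⟨x, Metric.mem_ball_self hε⟩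
    (convex_ball x ε).ordConnected (fun y hy => (hball hy).1.1)
    (((e.continuousOn.mono hsub).add continuousOn_const).congr hfF)
    ((((add_left_injective c).injOn.comp e.injOn (mapsTo_univ _ _)).mono hsub).congr hfF.symm),
    Metric.mem_ball_self hε⟩

lemma finite_Icc_diff_sUnion_branches (hZ : Z.Finite)
    (h : ∀ x ∈ Ioo 0 1, x ∉ Z → ∃ J, IsMonotoneInterval f J ∧ x ∈ J) :
    (Icc 0 1 \ ⋃₀ branches f).Finite := by
  refine (hZ.union (toFinite {0, 1})).subset ?_
  rintro x ⟨hx, hxf⟩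
  by_contra hxZ
  simp only [mem_union, mem_insert_iff, mem_singleton_iff, not_or] at hxZ
  obtain ⟨J, hJ, hxJ⟩ := h x ⟨hx.1.lt_of_ne' hxZ.2.1, hx.2.lt_of_ne hxZ.2.2⟩ hxZ.1
  obtain ⟨A, hA, hJA⟩ := hJ.exists_branch
  exact hxf ⟨A, hA, hJA hxJ⟩

lemma Icc_subset_closure_Ioo_diff (hS : S.Finite) : Icc 0 1 ⊆ closure (Ioo 0 1 \ S) := by
  rw [← closure_Ioo zero_ne_one]
  exact closure_minimal
    ((hS.countable.dense_compl ℝ).open_subset_closure_inter isOpen_Ioo) isClosed_closure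

namespace IsIntervalMapH

lemma eq_zero_and_eq_one_of_mapsTo (hf : IsIntervalMapH f) {n : ℕ} (hn : 1 ≤ n) {u v : ℝ}
    (hu : 0 ≤ u) (huv : u < v) (hv : v ≤ 1) (h : MapsTo f^[n] (Icc u v) (Icc u v)) :
    u = 0 ∧ v = 1 := by
  obtain ⟨x, hx, hdense⟩ := hf.mixing n hn
  have hperfect : Preperfect (Icc (0 : ℝ) 1) := isPreconnected_Icc.preperfect_of_nontrivial
    ⟨0, left_mem_Icc.2 zero_le_one, 1, right_mem_Icc.2 zero_le_one, zero_ne_one⟩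
  have hsub : Icc 0 1 ⊆ Icc u v := subset_of_dense_orbit hperfect (hf.mapsTo.iterate n) hx hdense
    isClosed_Icc h isOpen_Ioo
    ((nonempty_Ioo.2 huv).mono fun y hy => ⟨hy, hu.trans hy.1.le, hy.2.le.trans hv⟩)
    (inter_subset_left.trans Ioo_subset_Icc_self)
  obtain ⟨hu0, hv1⟩ := (Icc_subset_Icc_iff zero_le_one).1 hsub
  exact ⟨hu0.antisymm hu, hv.antisymm hv1⟩

lemma isPiecewiseMonotone (hf : IsIntervalMapH f) : IsPiecewiseMonotone f (Icc 0 1) where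
  Ioo_subset := Ioo_subset_Icc_self
  subset_Icc := Subset.rfl
  mapsTo := hf.mapsTo
  finite_exceptional := by
    refine finite_Icc_diff_sUnion_branches hf.finite_crit fun x hx hxZ => ?_
    have hnhds : Icc 0 1 ∈ 𝓝 x := Icc_mem_nhds hx.1 hx.2
    refine exists_isMonotoneInterval_of_hasStrictDerivAt (F := f) (c := 0) hx
      ((hf.contDiffOn.contDiffAt hnhds).hasStrictDerivAt two_ne_zero) ?_ (by simp)
    rw [← derivWithin_of_mem_nhds hnhds]
    exact fun h => hxZ ⟨Ioo_subset_Icc_self hx, h⟩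

lemma isMixingPiecewiseMonotone (hf : IsIntervalMapH f) :
    IsMixingPiecewiseMonotone f (Icc 0 1) where
  toIsPiecewiseMonotone := hf.isPiecewiseMonotone
  not_mapsTo_Icc := fun n hn p q hp hpq hq h =>
    hp.ne' (hf.eq_zero_and_eq_one_of_mapsTo hn hp.le hpq hq.le h).1
  covers := by
    rintro D hD hDo ⟨x, hx⟩ hDsub k hk hDk
    have hk2 : 1 ≤ k * 2 := by lia
    have htwo : (f^[k])^[2] = f^[k * 2] := (Function.iterate_mul f k 2).symm
    obtain ⟨i, hi⟩ := exists_Icc_subset_image_iterate zero_lt_one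
      (hf.contDiffOn.continuousOn.iterate hf.mapsTo k) (hf.mapsTo.iterate k)
      (fun u v hu huv hv h => hf.eq_zero_and_eq_one_of_mapsTo hk2 hu huv hv (htwo ▸ h))
      (fun e he hfix => by
        rw [htwo] at hfix ⊢
        exact hf.repelling e he _ hk2 hfix)
      (hDsub.trans Ioo_subset_Icc_self) hDo (infinite_of_mem_nhds x (hD.mem_nhds hx)).nontrivial hDk
    refine ⟨k * i, ?_⟩
    rw [Function.iterate_mul]
    exact Ioo_subset_Icc_self.trans hi

lemma isDenseFactor (hf : IsIntervalMapH f) : IsDenseFactor f (Icc 0 1) f (Icc 0 1) id where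
  isClosed := isClosed_Icc
  continuousOn := hf.contDiffOn.continuousOn
  mapsTo_self := hf.mapsTo
  mapsTo := mapsTo_id _
  semiconj := fun _ _ => rfl
  dist_le := fun x y => (Real.dist_eq x y).le
  dense := fun S hS => by simpa only [image_id] using Icc_subset_closure_Ioo_diff hS

end IsIntervalMapH

end SmoothMaps

/-! ### Smooth circle maps -/

section CircleMaps

lemma finite_inter_preimage_range_intCast {Y : Type*} [TopologicalSpace Y] {F : Y → ℝ} {s : Set Y}
    (hs : IsCompact s) (hF : Continuous F) (hne : ∀ z, ∀ᶠ x in 𝓝[≠] z, F x ≠ F z) :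
    (s ∩ F ⁻¹' range ((↑) : ℤ → ℝ)).Finite := by
  have hfiber : ∀ a, (s ∩ F ⁻¹' {a}).Finite := by
    intro a
    by_contra hinf
    obtain ⟨z, ⟨-, rfl⟩, hz⟩ := Set.Infinite.exists_accPt_of_subset_isCompact hinf
      (hs.inter_right (isClosed_singleton.preimage hF)) Subset.rfl
    obtain ⟨x, hx, hxz⟩ := ((accPt_iff_frequently_nhdsNE.1 hz).and_eventually (hne z)).exists
    exact hxz hx.2
  have hint : {j : ℤ | (j : ℝ) ∈ F '' s}.Finite :=
    (Int.isClosedEmbedding_coe_real.isCompact_preimage (hs.image hF)).finite_of_discrete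
  refine (hint.biUnion fun j _ => hfiber j).subset ?_
  rintro x ⟨hxs, j, hj⟩
  exact mem_biUnion (x := j) ⟨x, hxs, hj.symm⟩ ⟨hxs, hj.symm⟩

lemma coe_eq_coe_iff_exists_int {x y : ℝ} :
    (x : UnitAddCircle) = (y : UnitAddCircle) ↔ ∃ j : ℤ, x = y + j := by
  rw [← sub_eq_zero, ← AddCircle.coe_sub, AddCircle.coe_eq_zero_iff]
  simp only [zsmul_eq_mul, mul_one, eq_comm (b := x - y), sub_eq_iff_eq_add']

lemma exists_int_forall_eq_add {u v : ℝ → ℝ} (hu : Continuous u) (hv : Continuous v)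
    (h : ∀ x, (u x : UnitAddCircle) = (v x : UnitAddCircle)) : ∃ j : ℤ, ∀ x, u x = v x + j := by
  choose j hj using fun x => coe_eq_coe_iff_exists_int.1 (h x)
  have hcont : Continuous j := by
    rw [Int.isClosedEmbedding_coe_real.isEmbedding.continuous_iff]
    exact (hu.sub hv).congr fun x => sub_eq_iff_eq_add'.2 (hj x)
  exact ⟨j 0, fun x => PreconnectedSpace.constant inferInstance hcont (x := x) (y := 0) ▸ hj x⟩

lemma floor_sub_eq_floor_sub {S : Set ℝ} {w x y : ℝ} (hS : S.OrdConnected)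
    (hw : ∀ j : ℤ, w + j ∉ S) (hx : x ∈ S) (hy : y ∈ S) : ⌊x - w⌋ = ⌊y - w⌋ := by
  have hle : ∀ {x y : ℝ}, x ∈ S → y ∈ S → ⌊y - w⌋ ≤ ⌊x - w⌋ := by
    intro x y hx hy
    by_contra! hlt
    exact hw ⌊y - w⌋ (hS.out hx hy ⟨(sub_lt_iff_lt_add'.1 (Int.floor_lt.1 hlt)).le,
      le_sub_iff_add_le'.1 (Int.floor_le (y - w))⟩)
  exact le_antisymm (hle hy hx) (hle hx hy)

lemma exists_int_subset_image_add {G : ℝ → ℝ} {D : Set ℝ} {w : ℝ} (hG : ContinuousOn G D)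
    (hDo : D.OrdConnected) (hw : ∀ x ∈ D, (G x : UnitAddCircle) ≠ w)
    (hD : ∀ y ∈ D, ∃ x ∈ D, (y : UnitAddCircle) = G x) :
    ∃ c : ℤ, D ⊆ (fun x => G x + c) '' D := by
  rcases D.eq_empty_or_nonempty with rfl | ⟨x₀, hx₀⟩
  · exact ⟨0, empty_subset _⟩
  have hGo : (G '' D).OrdConnected := (hDo.isPreconnected.image _ hG).ordConnected
  have hGw : ∀ j : ℤ, w + j ∉ G '' D := by
    rintro j ⟨x, hx, hxj⟩
    exact hw x hx (coe_eq_coe_iff_exists_int.2 ⟨j, hxj⟩)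
  have hDw : ∀ j : ℤ, w + j ∉ D := by
    intro j hj
    obtain ⟨x, hx, hxj⟩ := hD _ hj
    exact hw x hx (hxj.symm.trans (coe_eq_coe_iff_exists_int.2 ⟨j, rfl⟩))
  refine ⟨⌊x₀ - w⌋ - ⌊G x₀ - w⌋, fun y hy => ?_⟩
  obtain ⟨x, hx, hxy⟩ := hD y hy
  obtain ⟨j, rfl⟩ := coe_eq_coe_iff_exists_int.1 hxy
  have hfloor : ⌊x₀ - w⌋ = ⌊G x₀ - w⌋ + j := by
    rw [← floor_sub_eq_floor_sub hDo hDw hy hx₀, add_sub_right_comm, Int.floor_add_intCast,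
      floor_sub_eq_floor_sub hGo hGw (mem_image_of_mem G hx) (mem_image_of_mem G hx₀)]
  exact ⟨x, hx, by simp only [hfloor, add_sub_cancel_left]⟩

lemma exists_closure_eq_Icc_of_forall_add_one_notMem {K : Set ℝ} (hKo : K.OrdConnected)
    (hKn : K.Nontrivial) (h : ∀ x ∈ K, x + 1 ∉ K) :
    ∃ p q, p < q ∧ q ≤ p + 1 ∧ closure K = Icc p q := by
  have hlt : ∀ x ∈ K, ∀ y ∈ K, y < x + 1 := fun x hx y hy => by
    by_contra! hxy
    exact h x hx (hKo.out hx hy ⟨(lt_add_one x).le, hxy⟩)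
  obtain ⟨x₀, hx₀⟩ := hKn.nonempty
  have ha : BddAbove K := ⟨x₀ + 1, fun y hy => (hlt x₀ hx₀ y hy).le⟩
  have hb : BddBelow K := ⟨x₀ - 1, fun y hy => (sub_lt_iff_lt_add.2 (hlt y hy x₀ hx₀)).le⟩
  obtain ⟨hpq, hcl⟩ := csInf_lt_csSup_and_closure_eq_Icc hKo hKn hb ha
  refine ⟨sInf K, sSup K, hpq, csSup_le hKn.nonempty fun y hy => ?_, hcl⟩
  exact sub_le_iff_le_add.1
    (le_csInf hKn.nonempty fun x hx => (sub_lt_iff_lt_add.2 (hlt x hx y hy)).le)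

variable {g : UnitAddCircle → UnitAddCircle} {F G H : ℝ → ℝ} {D : Set ℝ} {k n : ℕ}

lemma circleRep_mem (g : UnitAddCircle → UnitAddCircle) (x : ℝ) : circleRep g x ∈ Ico 0 1 := by
  have hmem := (AddCircle.equivIco (1 : ℝ) 0 (g x)).2
  exact ⟨hmem.1, hmem.2.trans_eq (zero_add 1)⟩

lemma semiconj_circleRep (g : UnitAddCircle → UnitAddCircle) :
    Function.Semiconj ((↑) : ℝ → UnitAddCircle) (circleRep g) g :=
  fun _ => AddCircle.coe_equivIco

lemma circleRep_eq_fract (hF : Function.Semiconj ((↑) : ℝ → UnitAddCircle) F g) (x : ℝ) :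
    circleRep g x = Int.fract (F x) := by
  rw [circleRep, ← hF]
  simpa only [div_one, mul_one] using AddCircle.coe_equivIco_mk_apply (p := (1 : ℝ)) (F x)

lemma Ioo_subset_image_iterate_circleRep (hn : 1 ≤ n)
    (h : ∀ z, ∃ x ∈ D, g^[n] (x : UnitAddCircle) = z) : Ioo 0 1 ⊆ (circleRep g)^[n] '' D := by
  intro z hz
  obtain ⟨x, hx, hxz⟩ := h z
  obtain ⟨m, rfl⟩ := Nat.exists_eq_add_of_le' hn
  have hmem : (circleRep g)^[m + 1] x ∈ Ico 0 1 := by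
    rw [Function.iterate_succ_apply']
    exact circleRep_mem g _
  refine ⟨x, hx, (AddCircle.coe_eq_coe_iff_of_mem_Ico (p := (1 : ℝ)) (a := 0)
    (by rwa [zero_add]) (by simpa only [zero_add] using Ioo_subset_Ico_self hz)).1 ?_⟩
  rw [(semiconj_circleRep g).iterate_right (m + 1) x, hxz]

namespace IsCircleMapH

lemma continuous (hg : IsCircleMapH g) : Continuous g := by
  obtain ⟨F, hFc, hF, -⟩ := hg.smooth
  refine QuotientAddGroup.isOpenQuotientMap_mk.continuous_comp_iff.1 ?_
  exact ((AddCircle.continuous_mk' 1).comp hFc.continuous).congr fun x => (hF x).symm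

lemma one_le_sub_of_mapsTo (hg : IsCircleMapH g) (hn : 1 ≤ n) {u v : ℝ} (huv : u < v)
    (h : MapsTo g^[n] ((↑) '' Icc u v) ((↑) '' Icc u v)) : 1 ≤ v - u := by
  by_contra! hlt
  obtain ⟨x, hdense⟩ := hg.mixing n hn
  have hsub : (univ : Set UnitAddCircle) ⊆ (↑) '' Icc u v := by
    have hhalf : ((1 / 2 : ℝ) : UnitAddCircle) ≠ 0 := by
      rw [Ne, AddCircle.coe_eq_zero_iff_of_mem_Ico] <;> norm_num
    refine subset_of_dense_orbit
      (isPreconnected_univ.preperfect_of_nontrivial ⟨_, mem_univ _, _, mem_univ _, hhalf⟩)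
      (mapsTo_univ _ _) (mem_univ x) hdense.closure_eq.ge
      (isCompact_Icc.image (AddCircle.continuous_mk' 1)).isClosed h
      (QuotientAddGroup.isOpenMap_coe _ (isOpen_Ioo (a := u) (b := v))) ?_ ?_
    · simpa only [inter_univ, image_nonempty, nonempty_Ioo] using huv
    · exact inter_subset_left.trans (image_mono Ioo_subset_Icc_self)
  obtain ⟨y, hy, hyw⟩ := hsub (mem_univ (((u + v + 1) / 2 : ℝ) : UnitAddCircle))
  obtain ⟨j, hj⟩ := coe_eq_coe_iff_exists_int.1 hyw
  have hj_gt : (-1 : ℤ) < j := by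
    have : (-1 : ℝ) < j := by linarith [hy.1]
    exact_mod_cast this
  have hj_lt : j < (0 : ℤ) := by
    have : (j : ℝ) < 0 := by linarith [hy.2]
    exact_mod_cast this
  lia

lemma one_lt_abs_deriv (hg : IsCircleMapH g) (hn : 1 ≤ n) (hG : Continuous G)
    (hGg : Function.Semiconj ((↑) : ℝ → UnitAddCircle) G g^[n]) {e : ℝ} (he : G e = e) :
    1 < |deriv G e| := by
  obtain ⟨F, hFc, hF, -, -, hrep⟩ := hg.smooth
  have hFg : Function.Semiconj ((↑) : ℝ → UnitAddCircle) F g := fun x => (hF x).symm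
  obtain ⟨j, hj⟩ := exists_int_forall_eq_add hG (hFc.continuous.iterate n) fun x =>
    (hGg x).trans (hFg.iterate_right n x).symm
  rw [funext hj, deriv_add_const]
  exact hrep e n hn (by rw [← hGg, he])

lemma exists_add_one_mem_image_iterate (hg : IsCircleMapH g) (hk : 1 ≤ k) (hH : Continuous H)
    (hHg : Function.Semiconj ((↑) : ℝ → UnitAddCircle) H g^[k]) (hDo : D.OrdConnected)
    (hDn : D.Nontrivial) (hDH : D ⊆ H '' D) :
    ∃ i, ∃ x ∈ H^[i] '' D, x + 1 ∈ H^[i] '' D := by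
  by_contra! hshort
  have hmono := monotone_image_iterate hDH
  set K : Set ℝ := ⋃ i, H^[i] '' D
  have hDi : ∀ i, D ⊆ H^[i] '' D := fun i => by simpa using hmono (Nat.zero_le i)
  have hDK : D ⊆ K := (hDi 0).trans (subset_iUnion (fun i => H^[i] '' D) 0)
  have hKo : K.OrdConnected := (isPreconnected_iUnion (hDn.nonempty.mono (subset_iInter hDi))
    fun i => hDo.isPreconnected.image _ (hH.iterate i).continuousOn).ordConnected
  have hKm : MapsTo H K K := mapsTo_iff_image_subset.2 (image_iUnion_image_iterate hDH).le
  obtain ⟨p, q, hpq, hlen, hcl⟩ := exists_closure_eq_Icc_of_forall_add_one_notMem hKo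
    (hDn.mono hDK) fun x hx hx1 => by
      obtain ⟨i, hi⟩ := mem_iUnion.1 hx
      obtain ⟨j, hj⟩ := mem_iUnion.1 hx1
      exact hshort (max i j) x (hmono (le_max_left i j) hi) (hmono (le_max_right i j) hj)
  have hm : MapsTo H (Icc p q) (Icc p q) := hcl ▸ hKm.closure hH
  have hiter : ∀ i, Function.Semiconj ((↑) : ℝ → UnitAddCircle) H^[i] g^[k * i] := fun i => by
    rw [Function.iterate_mul]
    exact hHg.iterate_right i
  have hk2 : 1 ≤ k * 2 := by lia
  obtain ⟨i, hi⟩ := exists_Icc_subset_image_iterate hpq hH.continuousOn hm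
    (fun u v hu huv hv h => by
      have := hg.one_le_sub_of_mapsTo hk2 huv ((hiter 2).mapsTo_image h)
      exact ⟨by linarith, by linarith⟩)
    (fun e he hfix => by
      have hd := hg.one_lt_abs_deriv hk2 (hH.iterate 2) (hiter 2) hfix
      have hdiff : DifferentiableAt ℝ H^[2] e :=
        differentiableAt_of_deriv_ne_zero fun h0 => by
          rw [h0, abs_zero] at hd
          exact zero_lt_one.not_gt hd
      rwa [hdiff.derivWithin (uniqueDiffOn_Icc hpq e he)])
    (hDK.trans (subset_closure.trans hcl.le)) hDo hDn hDH
  have hfull := hg.one_le_sub_of_mapsTo hk hpq (hHg.mapsTo_image hm)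
  obtain rfl : q = p + 1 := by linarith
  exact hshort i p (hi (left_mem_Icc.2 hpq.le)) (hi (right_mem_Icc.2 hpq.le))

/- If `g^[k]` misses a point on the interval `D`, then some lift `H` of `g^[k]` satisfies
`D ⊆ H '' D`, so the images `H^[i] '' D` increase, and one of them has length at least one. -/
lemma exists_Ioo_subset_image_iterate (hg : IsCircleMapH g) (hDo : D.OrdConnected)
    (hDn : D.Nontrivial) (hk : 1 ≤ k) (hDk : D ⊆ (circleRep g)^[k] '' D) :
    ∃ N, Ioo 0 1 ⊆ (circleRep g)^[N] '' D := by
  by_cases hsurj : ∀ z, ∃ x ∈ D, g^[k] (x : UnitAddCircle) = z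
  · exact ⟨k, Ioo_subset_image_iterate_circleRep hk hsurj⟩
  push Not at hsurj
  obtain ⟨w, hw⟩ := hsurj
  obtain ⟨w, rfl⟩ := QuotientAddGroup.mk_surjective w
  obtain ⟨F, hFc, hF, -⟩ := hg.smooth
  have hFk : Function.Semiconj ((↑) : ℝ → UnitAddCircle) F^[k] g^[k] :=
    Function.Semiconj.iterate_right (fun x => (hF x).symm) k
  have hFkc : Continuous F^[k] := hFc.continuous.iterate k
  obtain ⟨c, hc⟩ := exists_int_subset_image_add (w := w) hFkc.continuousOn hDo
    (fun x hx => hFk x ▸ hw x hx) (by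
      rintro _ hy
      obtain ⟨x, hx, rfl⟩ := hDk hy
      exact ⟨x, hx, ((semiconj_circleRep g).iterate_right k x).trans (hFk x).symm⟩)
  set H : ℝ → ℝ := fun x => F^[k] x + c
  have hHc : Continuous H := hFkc.add continuous_const
  have hH : Function.Semiconj ((↑) : ℝ → UnitAddCircle) H g^[k] := fun x =>
    (coe_eq_coe_iff_exists_int.2 ⟨c, rfl⟩).trans (hFk x)
  obtain ⟨i, x, hx, hx1⟩ := hg.exists_add_one_mem_image_iterate hk hHc hH hDo hDn hc
  have hio : (H^[i + 1] '' D).OrdConnected :=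
    (hDo.isPreconnected.image _ (hHc.iterate _).continuousOn).ordConnected
  have hstep := monotone_image_iterate hc i.le_succ
  refine ⟨k * (i + 1), Ioo_subset_image_iterate_circleRep (Nat.mul_pos hk i.succ_pos) fun z => ?_⟩
  obtain ⟨_, hy, rfl⟩ := (AddCircle.coe_image_Icc_eq (1 : ℝ) x).ge (mem_univ z)
  obtain ⟨y, hyD, rfl⟩ := hio.out (hstep hx) (hstep hx1) hy
  exact ⟨y, hyD, by rw [Function.iterate_mul, hH.iterate_right]⟩

lemma isPiecewiseMonotone (hg : IsCircleMapH g) :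
    IsPiecewiseMonotone (circleRep g) (Ico 0 1) where
  Ioo_subset := Ioo_subset_Ico_self
  subset_Icc := Ico_subset_Icc_self
  mapsTo := fun x _ => circleRep_mem g x
  finite_exceptional := by
    obtain ⟨F, hFc, hF, hcrit, hflat, -⟩ := hg.smooth
    have hisolated : ∀ z, ∀ᶠ x in 𝓝[≠] z, F x ≠ F z := by
      intro z
      by_cases hd : deriv F z = 0
      · obtain ⟨l, -, K, hK, h⟩ := hflat z hd
        filter_upwards [mem_nhdsWithin_of_mem_nhds h, self_mem_nhdsWithin] with x hx hxz heq
        have hxz' : 0 < |x - z| := abs_pos.2 (sub_ne_zero.2 hxz)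
        have hpos : 0 < K⁻¹ * |x - z| ^ l := by positivity
        rw [heq, sub_self, abs_zero] at hx
        exact hpos.not_ge hx.1
      · exact (differentiableAt_of_deriv_ne_zero hd).hasDerivAt.eventually_ne hd
    refine finite_Icc_diff_sUnion_branches (hcrit.union
      (finite_inter_preimage_range_intCast (isCompact_Icc (a := 0) (b := 1)) hFc.continuous
        hisolated))
      fun x hx hxZ => ?_
    rw [mem_union, not_or] at hxZ
    refine exists_isMonotoneInterval_of_hasStrictDerivAt (F := F) (c := -⌊F x⌋) hx
      (hFc.contDiffAt.hasStrictDerivAt two_ne_zero)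
      (fun h => hxZ.1 ⟨Ioo_subset_Ico_self hx, h⟩) ?_
    have hfloor : (⌊F x⌋ : ℝ) < F x :=
      (Int.floor_le _).lt_of_ne fun h => hxZ.2 ⟨Ioo_subset_Icc_self hx, _, h⟩
    filter_upwards [hFc.continuous.continuousAt.eventually
      (Ioo_mem_nhds hfloor (Int.lt_floor_add_one _))] with y hy
    rw [circleRep_eq_fract (fun x => (hF x).symm), Int.fract, Int.floor_eq_iff.2 ⟨hy.1.le, hy.2⟩,
      sub_eq_add_neg]

lemma isMixingPiecewiseMonotone (hg : IsCircleMapH g) :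
    IsMixingPiecewiseMonotone (circleRep g) (Ico 0 1) where
  toIsPiecewiseMonotone := hg.isPiecewiseMonotone
  not_mapsTo_Icc := fun n hn p q hp hpq hq h => by
    linarith [hg.one_le_sub_of_mapsTo hn hpq
      (((semiconj_circleRep g).iterate_right n).mapsTo_image h)]
  covers := by
    rintro D hD hDo ⟨x, hx⟩ - k hk hDk
    exact hg.exists_Ioo_subset_image_iterate hDo
      (infinite_of_mem_nhds x (hD.mem_nhds hx)).nontrivial hk hDk

lemma isDenseFactor (hg : IsCircleMapH g) :
    IsDenseFactor (circleRep g) (Ico 0 1) g univ ((↑) : ℝ → UnitAddCircle) where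
  isClosed := isClosed_univ
  continuousOn := hg.continuous.continuousOn
  mapsTo_self := mapsTo_univ _ _
  mapsTo := mapsTo_univ _ _
  semiconj := fun x _ => (semiconj_circleRep g x).symm
  dist_le := fun x y => by
    rw [dist_eq_norm, ← AddCircle.coe_sub, ← Real.norm_eq_abs]
    exact QuotientAddGroup.norm_mk_le_norm
  dense := fun S hS => by
    rw [← AddCircle.coe_image_Icc_eq (1 : ℝ) 0, zero_add]
    exact (image_mono (Icc_subset_closure_Ioo_diff hS)).trans
      (image_closure_subset_closure_image (AddCircle.continuous_mk' 1))

end IsCircleMapH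

end CircleMaps

/-! ### The pressure of the tower -/

section TowerPressure

open ExpGrowth

variable {f φ : ℝ → ℝ} {X : Set ℝ} {E : Set (Set ℝ)} {a b P : ℝ} {k : ℕ}
  {Chat : Set (ℝ × Set ℝ)}

lemma IsMixingPiecewiseMonotone.exists_tendsto_log_topSum (hf : IsMixingPiecewiseMonotone f X)
    (hφ : MapsTo φ X (Icc a b)) :
    ∃ P : ℝ, Tendsto (fun n : ℕ => ENNReal.log (topSum f φ n) / n) atTop (𝓝 (P : EReal)) :=
  exists_tendsto_log_div_of_submultiplicative hf.topSum_add_le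
    (hf.topSum_ne_top fun _ hx => (hφ hx).2) (hf.expE_le_topSum fun _ hx => (hφ hx).1)

lemma IsPiecewiseMonotone.lt_expGrowthSup_topSum (hf : IsPiecewiseMonotone f X)
    (ha : ∀ x ∈ X, a ≤ φ x)
    (hab : ((b - a : ℝ) : EReal) < expGrowthSup (fun n => ((cylinders f n).ncard : ENNReal))) :
    b < expGrowthSup (topSum f φ) := by
  calc (b : EReal) = ((b - a : ℝ) : EReal) + a := by rw [← EReal.coe_add, sub_add_cancel]
    _ < expGrowthSup (fun n => ((cylinders f n).ncard : ENNReal)) + a :=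
      EReal.add_lt_add_right_coe hab a
    _ ≤ expGrowthSup (topSum f φ) := hf.expGrowthSup_ncard_add_le ha

variable (hE : IsTransitivePart f E) (hf : IsMixingPiecewiseMonotone f X)
  (hφ : MapsTo φ X (Icc a b)) (hβ : (fun n => beta f φ n) =o[atTop] fun n : ℕ => (n : ℝ))
  (hP : Tendsto (fun n : ℕ => ENNReal.log (topSum f φ n) / n) atTop (𝓝 (P : EReal)))
  (hChat : Chat ∈ hatCylinders f E k)
include hE hf hφ hβ hP hChat

lemma IsTransitivePart.tendsto_log_hatTopSum :
    Tendsto (fun n : ℕ => ENNReal.log (hatTopSum f φ Chat n) / n) atTop (𝓝 (P : EReal)) := by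
  obtain ⟨D, hD, C, hC, hne, rfl⟩ := hChat
  exact tendsto_of_le_liminf_of_limsup_le
    (hP.liminf_eq.ge.trans (hE.expGrowthInf_topSum_le_hatTopSum hf hφ hβ hD hC hne))
    ((expGrowthSup_monotone (hatTopSum_le_topSum _ D)).trans hP.limsup_eq.le)

lemma IsTransitivePart.hatGurevich_eq (hbP : b < P) : hatGurevich f φ Chat = P := by
  obtain ⟨D, hD, C, hC, hne, rfl⟩ := hChat
  have hDsub := hf.subset_Ioo_of_mem_domains (hE.subset hD)
  refine le_antisymm ?_ ?_
  · refine (expGrowthSup_eventually_monotone ?_).trans hP.limsup_eq.le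
    filter_upwards [eventually_ge_atTop 1] with n hn
    exact hf.hatZ_le_topSum hDsub inter_subset_left hn
  · refine hP.liminf_eq.ge.trans (hE.expGrowthInf_topSum_le_hatZ hf hφ hβ hD hC hne ?_)
    exact (EReal.coe_lt_coe hbP).trans_eq hP.liminf_eq.symm

end TowerPressure

namespace MapH

lemma isMixingPiecewiseMonotone : ∀ T : MapH, IsMixingPiecewiseMonotone T.map T.space
  | .interval _ hf => hf.isMixingPiecewiseMonotone
  | .circle _ hg => hg.isMixingPiecewiseMonotone

lemma htop_le : ∀ T : MapH,
    T.htop ≤ ExpGrowth.expGrowthSup fun n => ((cylinders T.map n).ncard : ENNReal)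
  | .interval _ hf =>
    hf.isDenseFactor.coverEntropy_le hf.isMixingPiecewiseMonotone.toIsPiecewiseMonotone
  | .circle _ hg =>
    hg.isDenseFactor.coverEntropy_le hg.isMixingPiecewiseMonotone.toIsPiecewiseMonotone

end MapH

end HofbauerTower

end

open HofbauerTower in
theorem mainTheorem8_general {f φ : ℝ → ℝ} {X : Set ℝ} {a b : ℝ}
    (hf : IsMixingPiecewiseMonotone f X) (hφ : MapsTo φ X (Icc a b))
    (hab : ((b - a : ℝ) : EReal) <
      ExpGrowth.expGrowthSup fun n => ((cylinders f n).ncard : ENNReal))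
    (hβ : (fun n : ℕ => beta f φ n) =o[atTop] fun n : ℕ => (n : ℝ)) :
    ∃ P : ℝ,
      Tendsto (fun n : ℕ => ENNReal.log (topSum f φ n) / n) atTop (𝓝 (P : EReal)) ∧
      ∀ E : Set (Set ℝ), IsTransitivePart f E → ∀ k : ℕ, ∀ Chat ∈ hatCylinders f E k,
        Tendsto (fun n : ℕ => ENNReal.log (hatTopSum f φ Chat n) / n) atTop (𝓝 (P : EReal)) ∧
        hatGurevich f φ Chat = (P : EReal) := by
  obtain ⟨P, hP⟩ := hf.exists_tendsto_log_topSum hφ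
  have hbP : b < P := EReal.coe_lt_coe_iff.1
    ((hf.lt_expGrowthSup_topSum (fun _ hx => (hφ hx).1) hab).trans_eq hP.limsup_eq)
  exact ⟨P, hP, fun E hE k Chat hChat => ⟨hE.tendsto_log_hatTopSum hf hφ hβ hP hChat,
    hE.hatGurevich_eq hf hφ hβ hP hChat hbP⟩⟩

theorem mainTheorem8 (T : HofbauerTower.MapH) (φ : ℝ → ℝ)
    (hbddAbove : BddAbove (φ '' T.space)) (hbddBelow : BddBelow (φ '' T.space))
    (hrange : ((sSup (φ '' T.space) - sInf (φ '' T.space) : ℝ) : EReal) < T.htop)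
    (hbeta : (fun n : ℕ => HofbauerTower.beta T.map φ n) =o[atTop] (fun n : ℕ => (n : ℝ))) :
    ∃ P : ℝ,
      Tendsto (fun n : ℕ => ENNReal.log (HofbauerTower.topSum T.map φ n) / n) atTop
        (𝓝 (P : EReal)) ∧
      ∀ E : Set (Set ℝ), HofbauerTower.IsTransitivePart T.map E →
        ∀ k : ℕ, ∀ Chat ∈ HofbauerTower.hatCylinders T.map E k,
          Tendsto (fun n : ℕ => ENNReal.log (HofbauerTower.hatTopSum T.map φ Chat n) / n) atTop
            (𝓝 (P : EReal)) ∧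
          HofbauerTower.hatGurevich T.map φ Chat = (P : EReal) :=
  mainTheorem8_general T.isMixingPiecewiseMonotone
    (fun _ hx => ⟨csInf_le hbddBelow (mem_image_of_mem φ hx),
      le_csSup hbddAbove (mem_image_of_mem φ hx)⟩) (hrange.trans_le T.htop_le) hbeta
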